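/- Let $G=(N,E)$ be a finite undirected graph with link capacities $c_{ij}\ge 0$, a source $s$, a destination $d\neq s$, and distinct numerical node IDs. An embedded DAG $D$ gives each link of $G$ exactly one direction (keeping its capacity) without creating a directed cycle; $f^{\max}$ and $f^{\max}(D)$ are the maximum $s$–$d$ flows of $G$ and of $D$, and $D$ supports $\lambda$ if $\lambda\le f^{\max}(D)$. A cut is a set $X\ni s$ with $d\notin X$; its capacity in $D$ is the total capacity of the links of $D$ from $X$ to $X^c$; the smallest min-cut of $D$ is the min-cut with the fewest nodes on the source side. A vector $q\ge 0$ on $N$ with $q_d=0$ is a feasible overload vector of $D$ if for some $0\le f_{ij}\le c_{ij}$ on the links of $D$ one has $q_n=1_{[n=s]}\lambda+\sum_i f_{in}-\sum_j f_{nj}$ for all $n\ne d$; $q^{\min}(D)$ is the lexicographically smallest one (comparing components sorted in decreasing order). The link-reversal algorithm reverses every link $(i,j)$ of $D$ with $q^{\min}_i=0<q^{\min}_j$. Packets arrive at $s$ in amounts $A(t)\ge 0$, $t=0,1,2,\dots$, where $A$ is a random process with $\frac1t\sum_{\tau<t}A(\tau)\to\lambda$ almost surely. Node $n$ has backlog $Q_n(t)\ge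 0$ (arbitrary at $t=0$), and $Q_d(t)=0$. Backpressure on $D$ serves, in each slot $t$, the links $(i,j)$ of $D$ with $Q_i(t)>Q_j(t)$ one after the other (in any order), sending over $(i,j)$ the minimum of $c_{ij}$ and what is left of the backlog of $i$. The loop-free backpressure algorithm (LFBP) with periods $T_k\in\mathbb N$ and thresholds $R_k\in\mathbb R$ starts with the DAG $D_0$ that directs each link from the lower to the higher ID. In iteration $k=0,1,2,\dots$ it runs backpressure on $D_k$ for $T_k$ slots, keeping the backlogs from the previous iteration, and marks each node whose backlog exceeds $R_k$ in one of these slots; then $D_{k+1}$ is obtained by reversing all links from an unmarked to a marked node, and all marks are erased. Suppose $\lambda\le f^{\max}$. Then there is a number $K$ of iterations, which does not depend on the arrivals, such that the following holds. Call a run of LFBP correct if $D_0,\dots,D_K$ are embedded DAGs, $D_K$ supports $\lambda$, none of $D_0,\dots,D_{K-1}$ does, and for every $k<K$ the set marked in iteration $k$ is the source side of the smallest min-cut of $D_k$, which is unique, and is the set $\{n: q^{\min}_n(D_k)>0\}$ of overloaded nodes, so that $D_{k+1}$ is the result of the link-reversal algorithm on $D_k$. (a) Almost surely, the run is correct whenever,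 for each $k<K$, $R_k$ is large enough (by a bound that depends only on the network, $\lambda$, $D_k$ and the backlogs at the start of iteration $k$, not on the arrivals) and then $T_k$ is large enough (by a bound that may depend on $R_k$, the state at the start of iteration $k$, and the sample path of the arrivals). (b) For every $\varepsilon>0$ there are non-random sequences $(T_k)$, $T_k\ge1$, and $(R_k)$ with which LFBP almost surely finds, after finitely many iterations, a DAG that supports $\lambda$, and with which the run is correct with probability at least $1-\varepsilon$. -/

import Mathlib

open MeasureTheory Filter Topology
open scoped Classical

noncomputable section

/-- A network: an undirected graph `G` on a finite set of nodes, link capacities `c`,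
a source `s`, a destination `d`, and unique numerical node identifiers. -/
structure Network (N : Type*) [Fintype N] where
  G : SimpleGraph N
  c : Sym2 N → ℝ
  c_nonneg : ∀ e ∈ G.edgeSet, 0 ≤ c e
  s : N
  d : N
  s_ne_d : s ≠ d
  ident : N → ℕ
  ident_injective : Function.Injective ident

namespace Network

variable {N : Type*} [Fintype N] (W : Network N)

/-! ### Flows, cuts and embedded DAGs.  A directed graph is its set of links `E i j`. -/

/-- `E` gives each link of `G` exactly one direction, and has no directed cycle. -/
structure IsEmbeddedDAG (E : N → N → Prop) : Prop where
  links : ∀ i j, W.G.Adj i j ↔ (E i j ∨ E j i)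
  one_direction : ∀ i j, E i j → ¬ E j i
  acyclic : ∀ n, ¬ Relation.TransGen E n n

/-- Capacity of the ordered pair `(i, j)` in the directed graph `E`. -/
def cap (E : N → N → Prop) (i j : N) : ℝ :=
  if E i j then W.c s(i, j) else 0

/-- `f` is nonnegative and conserved at all nodes other than the source and destination. -/
structure IsFlow (f : N → N → ℝ) : Prop where
  nonneg : ∀ i j, 0 ≤ f i j
  conservation : ∀ n, n ≠ W.s → n ≠ W.d → ∑ i, f i n = ∑ j, f n j

/-- The value of a flow: the net flow out of the source. -/
def flowValue (f : N → N → ℝ) : ℝ := ∑ j, f W.s j - ∑ i, f i W.s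

/-- The maximum flow of the undirected network `G`, where the two directions of a link
share its capacity. -/
def maxFlowG : ℝ :=
  sSup {v | ∃ f : N → N → ℝ, W.IsFlow f ∧
    (∀ i j, W.G.Adj i j → f i j + f j i ≤ W.c s(i, j)) ∧
    (∀ i j, ¬ W.G.Adj i j → f i j = 0) ∧ W.flowValue f = v}

/-- The maximum flow of the directed graph `E`. -/
def maxFlow (E : N → N → Prop) : ℝ :=
  sSup {v | ∃ f : N → N → ℝ, W.IsFlow f ∧ (∀ i j, f i j ≤ W.cap E i j) ∧ W.flowValue f = v}

/-- `(X, Xᶜ)` is a cut. -/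
def IsCut (X : Finset N) : Prop := W.s ∈ X ∧ W.d ∉ X

/-- Total capacity of the links of `E` from `X` to its complement. -/
def cutCap (E : N → N → Prop) (X : Finset N) : ℝ := ∑ i ∈ X, ∑ j ∈ Xᶜ, W.cap E i j

def IsMinCut (E : N → N → Prop) (X : Finset N) : Prop :=
  W.IsCut X ∧ ∀ Y, W.IsCut Y → W.cutCap E X ≤ W.cutCap E Y

/-- A min-cut with the smallest number of nodes on the source side. -/
def IsSmallestMinCut (E : N → N → Prop) (X : Finset N) : Prop :=
  W.IsMinCut E X ∧ ∀ Y, W.IsMinCut E Y → X.card ≤ Y.card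

/-! ### Lexicographically minimal overload vectors and the link-reversal algorithm -/

/-- `q` is a feasible queue overload vector of `E` for the arrival rate `lam`. -/
def IsFeasibleOverload (lam : ℝ) (E : N → N → Prop) (q : N → ℝ) : Prop :=
  (∀ n, 0 ≤ q n) ∧ q W.d = 0 ∧
    ∃ f : N → N → ℝ, (∀ i j, 0 ≤ f i j ∧ f i j ≤ W.cap E i j) ∧
      ∀ n, n ≠ W.d → q n = (if n = W.s then lam else 0) + ∑ i, f i n - ∑ j, f n j

/-- The components of `u`, in decreasing order. -/
def sortedDesc (u : N → ℝ) : List ℝ := (Finset.univ.val.map u).sort (· ≥ ·)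

/-- `u` is lexicographically smaller than `v`: the vectors of their components in decreasing
order are compared lexicographically. -/
def LexLT (u v : N → ℝ) : Prop := sortedDesc u < sortedDesc v

/-- `q` is a lexicographically smallest feasible overload vector. -/
def IsLexMinOverload (lam : ℝ) (E : N → N → Prop) (q : N → ℝ) : Prop :=
  W.IsFeasibleOverload lam E q ∧ ∀ q', W.IsFeasibleOverload lam E q' → ¬ LexLT q' q

/-- The links after the link-reversal algorithm with overload vector `q`: the links `(i, j)`
with `q i = 0` and `0 < q j` are reversed, the others are kept. -/
def linkReversal (q : N → ℝ) (E : N → N → Prop) : N → N → Prop := fun i j =>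
  (E i j ∧ ¬ (q i = 0 ∧ 0 < q j)) ∨ (E j i ∧ (q j = 0 ∧ 0 < q i))

/-! ### Backpressure on a directed graph -/

/-- Packets that backpressure sends over `(i, j)` in a slot which starts with the backlogs `Q`.
The links out of `i` are served one after the other, in increasing order of `rank i`; a link
`(i, j)` with `Q j < Q i` carries the minimum of its capacity and what is left of the backlog
of `i`. -/
def bpTransmit (rank : N → N → ℕ) (E : N → N → Prop) (Q : N → ℝ) (i j : N) : ℝ :=
  if E i j ∧ Q j < Q i then
    min (W.cap E i j)
      (max 0 (Q i - ∑ j' with E i j' ∧ Q j' < Q i ∧ rank i j' < rank i j, W.cap E i j'))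
  else 0

/-- Backlogs after a slot with backlogs `Q` at its start and `a` arrivals at the source; the
destination keeps no backlog. -/
def bpStep (rank : N → N → ℕ) (E : N → N → Prop) (a : ℝ) (Q : N → ℝ) : N → ℝ := fun n =>
  if n = W.d then 0
  else Q n + (if n = W.s then a else 0)
    + ∑ i, W.bpTransmit rank E Q i n - ∑ j, W.bpTransmit rank E Q n j

/-- Backlogs `τ` slots after time `t`, under backpressure on `E`, from the backlogs `Q` at
time `t`; `A` is the arrival sequence and `rank t` the service order in slot `t`. -/
def bpQueue (rank : ℕ → N → N → ℕ) (A : ℕ → ℝ) (E : N → N → Prop) (t : ℕ) (Q : N → ℝ) :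
    ℕ → N → ℝ
  | 0 => Q
  | τ + 1 => W.bpStep (rank (t + τ)) E (A (t + τ)) (bpQueue rank A E t Q τ)

/-! ### The loop-free backpressure algorithm (LFBP) -/

/-- The initial DAG: every link goes from the lower to the higher identifier. -/
def initialDAG : N → N → Prop := fun i j => W.G.Adj i j ∧ W.ident i < W.ident j

/-- The links after reversing those that go from an unmarked to a marked node. -/
def reverseMarked (M : Finset N) (E : N → N → Prop) : N → N → Prop := fun i j =>
  (E i j ∧ ¬ (i ∉ M ∧ j ∈ M)) ∨ (E j i ∧ (j ∉ M ∧ i ∈ M))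

/-- The nodes whose backlog exceeds the threshold `r` in one of the `T` slots
`t, …, t + T - 1`, when backpressure is run on `E` from the backlogs `Q` at time `t`. -/
def marked (rank : ℕ → N → N → ℕ) (A : ℕ → ℝ) (E : N → N → Prop) (t : ℕ) (Q : N → ℝ)
    (T : ℕ) (r : ℝ) : Finset N :=
  Finset.univ.filter fun n => ∃ τ < T, r < W.bpQueue rank A E t Q τ n

/-- The data with which LFBP starts an iteration: the time, the current directed graph and the
backlogs.  All nodes are unmarked at that moment. -/
structure LFBPState (N : Type*) where
  time : ℕ
  links : N → N → Prop
  queue : N → ℝ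

/-- The nodes that LFBP has marked as overloaded at the end of an iteration which starts in
state `S`, has length `T` and threshold `r`. -/
def LFBPState.marked (S : LFBPState N) (rank : ℕ → N → N → ℕ) (A : ℕ → ℝ) (T : ℕ) (r : ℝ) :
    Finset N :=
  W.marked rank A S.links S.time S.queue T r

/-- The state of LFBP at the start of iteration `k`; iteration `k` lasts `T k` slots and uses
the threshold `R k`. -/
def lfbp (rank : ℕ → N → N → ℕ) (A : ℕ → ℝ) (Q₀ : N → ℝ) (T : ℕ → ℕ) (R : ℕ → ℝ) :
    ℕ → LFBPState N
  | 0 => ⟨0, W.initialDAG, Q₀⟩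
  | k + 1 =>
    let S := lfbp rank A Q₀ T R k
    { time := S.time + T k
      links := reverseMarked (LFBPState.marked W S rank A (T k) (R k)) S.links
      queue := W.bpQueue rank A S.links S.time S.queue (T k) }

/-- LFBP with the given inputs finds in iteration `K` a DAG that supports `lam`, and in each
earlier iteration the marked nodes are the source side of the (unique) smallest min-cut, they
are the overloaded nodes under the lexicographically smallest overload vector, and the
reversals are those of the link-reversal algorithm. -/
structure IsCorrectRun (lam : ℝ) (rank : ℕ → N → N → ℕ) (A : ℕ → ℝ) (Q₀ : N → ℝ)
    (T : ℕ → ℕ) (R : ℕ → ℝ) (K : ℕ) : Prop where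
  dag : ∀ k ≤ K, W.IsEmbeddedDAG (W.lfbp rank A Q₀ T R k).links
  supports : lam ≤ W.maxFlow (W.lfbp rank A Q₀ T R K).links
  not_supports : ∀ k < K, W.maxFlow (W.lfbp rank A Q₀ T R k).links < lam
  smallest_min_cut : ∀ k < K, ∀ X : Finset N,
    W.IsSmallestMinCut (W.lfbp rank A Q₀ T R k).links X ↔
      X = LFBPState.marked W (W.lfbp rank A Q₀ T R k) rank A (T k) (R k)
  exists_lexMin : ∀ k < K, ∃ q, W.IsLexMinOverload lam (W.lfbp rank A Q₀ T R k).links q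
  overloaded : ∀ k < K, ∀ q, W.IsLexMinOverload lam (W.lfbp rank A Q₀ T R k).links q →
    ∀ n, n ∈ LFBPState.marked W (W.lfbp rank A Q₀ T R k) rank A (T k) (R k) ↔ 0 < q n
  same_reversals : ∀ k < K, ∀ q, W.IsLexMinOverload lam (W.lfbp rank A Q₀ T R k).links q →
    (W.lfbp rank A Q₀ T R (k + 1)).links = linkReversal q (W.lfbp rank A Q₀ T R k).links

end Network

end

/-! The argument has a combinatorial half and a queueing half, and both rest on the smallest min-cut
`X` of the current DAG.

Combinatorics. If the DAG does not support `lam`, reversing the links into `X` makes every link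
across `X` point outwards. This creates no cycle, since a path that leaves `X` cannot return, and it
raises the capacity of `X` to at least `maxFlowG`. Submodularity then shows that the pair (min-cut
value, size of the smallest min-cut) strictly increases lexicographically
(`cutRank_lt_reverseStep`). There are finitely many directed graphs, so iteration reaches one that
supports `lam`. The first such index is `K`, and arrivals play no role in it.

Overload vectors. Feasible vectors of least Euclidean norm saturate all links from a higher to a
lower level and leave the opposite links empty. They are therefore extremal on every level set,
hence lexicographically smallest, and their support is `X` (`IsLexMinOverload.mem_iff`). The same
analysis gives max-flow min-cut.

Queues. Backlogs outside `X` stay below a bound that is independent of the arrivals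
(`bpQueue_le_backlogBound`), while all backlogs inside `X` grow beyond any threshold
(`IsSmallestMinCut.exists_overload_time`). Both proofs carry bounds for all sets of nodes
simultaneously, depending quadratically on the size of the set: concave above, convex below. A set
whose bound is nearly tight is then separated in backlog from the other nodes of its side, so that
backpressure uses the links between them fully in one direction and not at all in the other, and the
min-cut inequalities give the drift.

Probability. A threshold above the bound and a long enough period thus mark exactly `X`. In (a) the
period comes from the convergence rate on the sample path. In (b) deterministic choices fail in
iteration `k` with probability at most `e k`, where the `e k` sum to less than `ε`; a union bound
and Borel–Cantelli finish. -/

namespace Network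

/-! ### Fluxes between sets of nodes. -/

variable {N : Type*}

/-- The total of `f` over the ordered pairs in `A × B`. -/
noncomputable def flux (f : N → N → ℝ) (A B : Finset N) : ℝ := ∑ i ∈ A, ∑ j ∈ B, f i j

theorem flux_nonneg {f : N → N → ℝ} (hf : ∀ i j, 0 ≤ f i j) (A B : Finset N) :
    0 ≤ flux f A B :=
  Finset.sum_nonneg fun i _ => Finset.sum_nonneg fun j _ => hf i j

theorem flux_le_flux {f g : N → N → ℝ} {A B : Finset N}
    (h : ∀ i ∈ A, ∀ j ∈ B, f i j ≤ g i j) : flux f A B ≤ flux g A B :=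
  Finset.sum_le_sum fun i hi => Finset.sum_le_sum fun j hj => h i hi j hj

theorem flux_congr {f g : N → N → ℝ} {A B : Finset N}
    (h : ∀ i ∈ A, ∀ j ∈ B, f i j = g i j) : flux f A B = flux g A B :=
  Finset.sum_congr rfl fun i hi => Finset.sum_congr rfl fun j hj => h i hi j hj

theorem flux_eq_zero {f : N → N → ℝ} {A B : Finset N}
    (h : ∀ i ∈ A, ∀ j ∈ B, f i j = 0) : flux f A B = 0 :=
  Finset.sum_eq_zero fun i hi => Finset.sum_eq_zero fun j hj => h i hi j hj

theorem flux_mono {f : N → N → ℝ} (hf : ∀ i j, 0 ≤ f i j) {A A' B B' : Finset N}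
    (hA : A ⊆ A') (hB : B ⊆ B') : flux f A B ≤ flux f A' B' :=
  (Finset.sum_le_sum fun i _ =>
    Finset.sum_le_sum_of_subset_of_nonneg hB fun j _ _ => hf i j).trans
    (Finset.sum_le_sum_of_subset_of_nonneg hA fun i _ _ => Finset.sum_nonneg fun j _ => hf i j)

theorem flux_split_left (f : N → N → ℝ) {A A' : Finset N} (h : A ⊆ A') (B : Finset N) :
    flux f A' B = flux f A B + flux f (A' \ A) B := by
  rw [flux, ← Finset.sum_sdiff h, add_comm]; rfl

theorem flux_split_right (f : N → N → ℝ) (A : Finset N) {B B' : Finset N} (h : B ⊆ B') :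
    flux f A B' = flux f A B + flux f A (B' \ B) := by
  simp only [flux, ← Finset.sum_add_distrib]
  refine Finset.sum_congr rfl fun i _ => ?_
  rw [← Finset.sum_sdiff h, add_comm]

theorem linkReversal_eq_reverseMarked {q : N → ℝ} (hq : ∀ n, 0 ≤ q n) {X : Finset N}
    (h : ∀ n, n ∈ X ↔ 0 < q n) (E : N → N → Prop) : linkReversal q E = reverseMarked X E := by
  have h0 : ∀ n, q n = 0 ↔ n ∉ X := fun n => by
    rw [h, not_lt]; exact ⟨fun h => h.le, fun h' => le_antisymm h' (hq n)⟩
  funext i j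
  simp only [linkReversal, reverseMarked, h0, ← h]

variable [Fintype N]

theorem flux_eq (f : N → N → ℝ) (A B : Finset N) :
    flux f A B = ∑ i, ∑ j, if i ∈ A ∧ j ∈ B then f i j else 0 := by
  simp only [flux, ite_and, Finset.sum_ite_mem, Finset.univ_inter, Finset.sum_ite_irrel,
    Finset.sum_const_zero]

/-- The net flow into a set of nodes is the net flow through its boundary. -/
theorem sum_net_eq (f : N → N → ℝ) (Z : Finset N) :
    ∑ n ∈ Z, (∑ i, f i n - ∑ j, f n j) = flux f Zᶜ Z - flux f Z Zᶜ := by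
  have h1 : ∑ n ∈ Z, ∑ i, f i n = flux f Z Z + flux f Zᶜ Z := by
    rw [Finset.sum_comm, ← Finset.sum_add_sum_compl Z]; rfl
  have h2 : ∑ n ∈ Z, ∑ j, f n j = flux f Z Z + flux f Z Zᶜ := by
    simp only [flux, ← Finset.sum_add_distrib, Finset.sum_add_sum_compl]
  rw [Finset.sum_sub_distrib, h1, h2]; ring

/-! ### Cut capacities, submodularity and the smallest min-cut. -/

variable (W : Network N)

/-- Every capacity of the directed graph is nonnegative. -/
theorem IsEmbeddedDAG.cap_nonneg {W : Network N} {E : N → N → Prop} (hE : W.IsEmbeddedDAG E)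
    (i j : N) : 0 ≤ W.cap E i j := by
  unfold cap
  split_ifs with h
  · exact W.c_nonneg _ ((W.G.mem_edgeSet).2 ((hE.links i j).2 (Or.inl h)))
  · exact le_rfl

theorem cutCap_eq_flux (E : N → N → Prop) (X : Finset N) :
    W.cutCap E X = flux (W.cap E) X Xᶜ := rfl

theorem cutCap_eq (E : N → N → Prop) (X : Finset N) :
    W.cutCap E X = ∑ i, ∑ j, if i ∈ X ∧ j ∉ X then W.cap E i j else 0 := by
  simp [cutCap_eq_flux, flux_eq]

/-- Submodularity of cut capacities, where the capacities of one of the cuts may be raised within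
`X`, within its complement, and from `X` to its complement. -/
theorem cutCap_inter_add_union_le {E E' : N → N → Prop} (hE : ∀ i j, 0 ≤ W.cap E i j)
    (hE' : ∀ i j, 0 ≤ W.cap E' i j) {X : Finset N}
    (hsame : ∀ i j, (i ∈ X ↔ j ∈ X) → W.cap E i j ≤ W.cap E' i j)
    (hout : ∀ i j, i ∈ X → j ∉ X → W.cap E i j ≤ W.cap E' i j) (Y : Finset N) :
    W.cutCap E (Y ∩ X) + W.cutCap E (Y ∪ X) ≤ W.cutCap E' Y + W.cutCap E X := by
  simp only [cutCap_eq, ← Finset.sum_add_distrib]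
  -- The inequality holds pair by pair. Pairs from outside `X` into `X` never count on the left, so
  -- no comparison of `E` with `E'` is needed there; these are the links that the reversal removes.
  refine Finset.sum_le_sum fun i _ => Finset.sum_le_sum fun j _ => ?_
  have h1 := hE i j
  have h2 := hE' i j
  have h3 := hsame i j
  have h4 := hout i j
  simp only [Finset.mem_inter, Finset.mem_union]
  by_cases hiX : i ∈ X <;> by_cases hjX : j ∈ X <;> by_cases hiY : i ∈ Y <;>
    by_cases hjY : j ∈ Y <;> simp_all

theorem IsCut.inter {W : Network N} {X Y : Finset N} (hX : W.IsCut X) (hY : W.IsCut Y) :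
    W.IsCut (Y ∩ X) :=
  ⟨Finset.mem_inter.2 ⟨hY.1, hX.1⟩, fun h => hX.2 (Finset.mem_inter.1 h).2⟩

theorem IsCut.union {W : Network N} {X Y : Finset N} (hX : W.IsCut X) (hY : W.IsCut Y) :
    W.IsCut (Y ∪ X) :=
  ⟨Finset.mem_union_left _ hY.1, fun h => (Finset.mem_union.1 h).elim hY.2 hX.2⟩

theorem isCut_singleton : W.IsCut {W.s} :=
  ⟨Finset.mem_singleton_self _, fun h => W.s_ne_d (Finset.mem_singleton.1 h).symm⟩

/-- The smallest min-cut is contained in each cut whose intersection with it is a min-cut. -/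
theorem IsSmallestMinCut.subset_of_inter {W : Network N} {E : N → N → Prop} {X Y : Finset N}
    (hX : W.IsSmallestMinCut E X) (hY : W.IsCut Y)
    (h : W.cutCap E (Y ∩ X) ≤ W.cutCap E X) : X ⊆ Y := by
  have hm : W.IsMinCut E (Y ∩ X) :=
    ⟨hX.1.1.inter hY, fun Z hZ => h.trans (hX.1.2 Z hZ)⟩
  have := Finset.eq_of_subset_of_card_le (Finset.inter_subset_right (s₁ := Y) (s₂ := X))
    (hX.2 _ hm)
  exact this ▸ Finset.inter_subset_left

theorem IsSmallestMinCut.subset {W : Network N} {E : N → N → Prop}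
    (hE : ∀ i j, 0 ≤ W.cap E i j) {X Y : Finset N}
    (hX : W.IsSmallestMinCut E X) (hY : W.IsMinCut E Y) : X ⊆ Y := by
  refine hX.subset_of_inter hY.1 ?_
  have h1 := W.cutCap_inter_add_union_le hE hE (X := X) (fun _ _ _ => le_rfl)
    (fun _ _ _ _ => le_rfl) Y
  have h2 := hY.2 _ (hX.1.1.union hY.1)
  linarith

theorem exists_isSmallestMinCut (E : N → N → Prop) : ∃ X, W.IsSmallestMinCut E X := by
  obtain ⟨X, hX, hmin⟩ := Finset.exists_min_image
    (Finset.univ.filter fun X => W.IsCut X) (W.cutCap E)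
    ⟨{W.s}, by simpa using W.isCut_singleton⟩
  have hX' : W.IsMinCut E X := ⟨by simpa using hX, fun Y hY => hmin Y (by simpa using hY)⟩
  obtain ⟨Z, hZ, hmin⟩ := Finset.exists_min_image
    (Finset.univ.filter fun X => W.IsMinCut E X) Finset.card ⟨X, by simpa using hX'⟩
  exact ⟨Z, by simpa using hZ, fun Y hY => hmin Y (by simpa using hY)⟩

theorem IsSmallestMinCut.eq {W : Network N} {E : N → N → Prop}
    (hE : ∀ i j, 0 ≤ W.cap E i j) {X Y : Finset N}
    (hX : W.IsSmallestMinCut E X) (hY : W.IsSmallestMinCut E Y) : X = Y :=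
  (hX.subset hE hY.1).antisymm (hY.subset hE hX.1)

/-! ### Weak duality -/

theorem flux_net_eq_of_isFlow {W : Network N} {f : N → N → ℝ} (hf : W.IsFlow f) {X : Finset N}
    (hX : W.IsCut X) : W.flowValue f = flux f X Xᶜ - flux f Xᶜ X := by
  have h := sum_net_eq f X
  rw [Finset.sum_eq_single_of_mem W.s hX.1] at h
  · unfold flowValue; linarith
  · intro n hn hns
    rw [hf.conservation n hns (fun h => hX.2 (h ▸ hn)), sub_self]

theorem isFlow_zero : W.IsFlow (fun _ _ => 0) :=
  ⟨fun _ _ => le_rfl, fun _ _ _ => by simp⟩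

theorem flowValue_le_cutCap {W : Network N} {E : N → N → Prop} {f : N → N → ℝ}
    (hf : W.IsFlow f) (hcap : ∀ i j, f i j ≤ W.cap E i j) {X : Finset N} (hX : W.IsCut X) :
    W.flowValue f ≤ W.cutCap E X := by
  rw [flux_net_eq_of_isFlow hf hX, cutCap_eq_flux]
  have h1 := flux_nonneg hf.nonneg Xᶜ X
  have h2 : flux f X Xᶜ ≤ flux (W.cap E) X Xᶜ := flux_le_flux fun i _ j _ => hcap i j
  linarith

theorem maxFlow_le_cutCap {E : N → N → Prop} (hE : ∀ i j, 0 ≤ W.cap E i j) {X : Finset N}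
    (hX : W.IsCut X) : W.maxFlow E ≤ W.cutCap E X := by
  refine csSup_le ⟨_, _, W.isFlow_zero, hE, rfl⟩ ?_
  rintro v ⟨f, hf, hcap, rfl⟩
  exact flowValue_le_cutCap hf hcap hX

theorem le_maxFlow {E : N → N → Prop} {f : N → N → ℝ}
    (hf : W.IsFlow f) (hcap : ∀ i j, f i j ≤ W.cap E i j) :
    W.flowValue f ≤ W.maxFlow E := by
  refine le_csSup ⟨W.cutCap E {W.s}, ?_⟩ ⟨f, hf, hcap, rfl⟩
  rintro v ⟨g, hg, hcap, rfl⟩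
  exact flowValue_le_cutCap hg hcap W.isCut_singleton

theorem maxFlowG_le_flux {X : Finset N} (hX : W.IsCut X) :
    W.maxFlowG ≤ flux (W.cap W.G.Adj) X Xᶜ := by
  refine csSup_le ⟨_, _, W.isFlow_zero, fun i j h => ?_, fun _ _ _ => rfl, rfl⟩ ?_
  · simpa using W.c_nonneg _ ((W.G.mem_edgeSet).2 h)
  rintro v ⟨f, hf, hcap, hadj, rfl⟩
  rw [flux_net_eq_of_isFlow hf hX]
  have h1 := flux_nonneg hf.nonneg Xᶜ X
  have h2 : flux f X Xᶜ ≤ flux (W.cap W.G.Adj) X Xᶜ := flux_le_flux fun i _ j _ => by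
    unfold cap
    split_ifs with h
    · linarith [hcap i j h, hf.nonneg j i]
    · exact (hadj i j h).le
  linarith

/-! ### Overload vectors of least norm -/

section Overload

variable {W} {lam : ℝ} {E : N → N → Prop}

/-- Summing the balance equations over `Z` leaves the boundary fluxes; the inflow is nonnegative and
the outflow is at most the cut capacity. Least-norm vectors attain equality on their level sets,
which is the source of their extremality. -/
theorem IsFeasibleOverload.le_sum {q : N → ℝ} (hq : W.IsFeasibleOverload lam E q)
    {Z : Finset N} (hZ : W.d ∉ Z) :
    (if W.s ∈ Z then lam else 0) - W.cutCap E Z ≤ ∑ n ∈ Z, q n := by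
  obtain ⟨_, _, f, hf, hqf⟩ := hq
  have h : ∑ n ∈ Z, q n = (if W.s ∈ Z then lam else 0) + (flux f Zᶜ Z - flux f Z Zᶜ) := by
    rw [← sum_net_eq, ← Finset.sum_ite_eq' Z W.s (fun _ => lam), ← Finset.sum_add_distrib]
    refine Finset.sum_congr rfl fun n hn => ?_
    rw [hqf n (fun h => hZ (h ▸ hn))]; ring
  have h1 := flux_nonneg (fun i j => (hf i j).1) Zᶜ Z
  have h2 : flux f Z Zᶜ ≤ flux (W.cap E) Z Zᶜ := flux_le_flux fun i _ j _ => (hf i j).2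
  rw [h, cutCap_eq_flux]
  linarith

variable (W lam E) in
/-- `q` is a feasible overload vector of least Euclidean norm. -/
def IsLeastNormOverload (q : N → ℝ) : Prop :=
  W.IsFeasibleOverload lam E q ∧
    ∀ q', W.IsFeasibleOverload lam E q' → ∑ n, q n ^ 2 ≤ ∑ n, q' n ^ 2

/-- Compactness of the set of admissible flows: the overload vector depends continuously on the
flow. -/
theorem exists_isLeastNormOverload (hlam : 0 ≤ lam) (hE : ∀ i j, 0 ≤ W.cap E i j) :
    ∃ q, W.IsLeastNormOverload lam E q := by
  let net : (N → N → ℝ) → N → ℝ := fun f n =>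
    if n = W.d then 0 else (if n = W.s then lam else 0) + ∑ i, f i n - ∑ j, f n j
  have hnet : ∀ n, Continuous fun f => net f n := by
    intro n
    by_cases h : n = W.d
    · simp only [net, h, if_true]; exact continuous_const
    · simp only [net, h, if_false]; fun_prop
  have hK : IsCompact (Set.Icc 0 (W.cap E) ∩ {f | ∀ n, 0 ≤ net f n}) := by
    refine isCompact_Icc.inter_right ?_
    simp only [Set.ofPred_forall]
    exact isClosed_iInter fun n => isClosed_le continuous_const (hnet n)
  obtain ⟨f, ⟨hf, hfn⟩, hmin⟩ := hK.exists_isMinOn (f := fun f => ∑ n, net f n ^ 2)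
    ⟨0, ⟨le_rfl, fun i j => hE i j⟩, fun n => by
      simp only [net]; split_ifs <;> simp [hlam]⟩
    (Continuous.continuousOn (continuous_finsetSum _ fun n _ => (hnet n).pow 2))
  refine ⟨net f, ⟨hfn, by simp [net], f, fun i j => ⟨hf.1 i j, hf.2 i j⟩,
    fun n hn => by simp [net, hn]⟩, ?_⟩
  rintro q' ⟨h0, hd, f', hf', hq'⟩
  have he : q' = net f' := by
    funext n
    by_cases h : n = W.d
    · simp [net, h, hd]
    · simp only [net, h, if_false]; exact hq' n h
  rw [he]
  exact hmin ⟨⟨fun i j => (hf' i j).1, fun i j => (hf' i j).2⟩, fun n => he ▸ h0 n⟩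

/-- Changing the flow over one link does not decrease the norm of the least overload vector. -/
theorem IsLeastNormOverload.perturb {q : N → ℝ} (hq : W.IsLeastNormOverload lam E q)
    {f : N → N → ℝ} (hf : ∀ i j, 0 ≤ f i j ∧ f i j ≤ W.cap E i j)
    (hqf : ∀ n, n ≠ W.d → q n = (if n = W.s then lam else 0) + ∑ i, f i n - ∑ j, f n j)
    {u v : N} (huv : u ≠ v) {e : ℝ} (h0 : 0 ≤ f u v + e) (h1 : f u v + e ≤ W.cap E u v)
    (hu : 0 ≤ q u - e) (hv : 0 ≤ q v + e) : 0 ≤ e * (q v - q u) + e ^ 2 := by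
  -- Pushing `e` more over `(u, v)` moves `e` of overload from `u` to `v`. If `u` or `v` is the
  -- destination, its entry is then reset to zero, which does not increase the norm.
  let g : N → ℝ := fun n => q n + ((if n = v then e else 0) - (if n = u then e else 0))
  have hg0 : ∀ n, 0 ≤ g n := by
    intro n
    have := hq.1.1 n
    simp only [g]
    split_ifs with h1 h2 h2
    · exact absurd (h2.symm.trans h1) huv
    · subst h1; linarith
    · subst h2; linarith
    · linarith
  have hfeas : W.IsFeasibleOverload lam E (fun n => if n = W.d then 0 else g n) := by
    refine ⟨fun n => ?_, by simp, fun i j => f i j + if i = u then (if j = v then e else 0) else 0,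
      fun i j => ?_, fun n hn => ?_⟩
    · dsimp only
      split_ifs
      exacts [le_rfl, hg0 n]
    · have := hf i j
      dsimp only
      split_ifs with hi hj
      · subst hi hj; exact ⟨h0, h1⟩
      · simpa using this
      · simpa using this
    · simp only [hn, if_false, g, hqf n hn, Finset.sum_add_distrib, Finset.sum_ite_eq',
        Finset.sum_ite_irrel, Finset.sum_const_zero, Finset.mem_univ, if_true]
      ring
  have h := hq.2 _ hfeas
  have h2 : ∑ n, (if n = W.d then 0 else g n) ^ 2 ≤ ∑ n, g n ^ 2 :=
    Finset.sum_le_sum fun n _ => by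
      split_ifs
      · simpa using sq_nonneg (g n)
      · exact le_rfl
  have h3 : ∑ n, g n ^ 2 = ∑ n, q n ^ 2 + 2 * (e * (q v - q u) + e ^ 2) := by
    have : ∀ n, g n ^ 2 = q n ^ 2 + ((if n = v then 2 * e * q v + e ^ 2 else 0) +
        (if n = u then - 2 * e * q u + e ^ 2 else 0)) := by
      intro n
      simp only [g]
      split_ifs with h1 h2 h2
      · exact absurd (h2.symm.trans h1) huv
      · subst h1; ring
      · subst h2; ring
      · ring
    simp only [this, Finset.sum_add_distrib, Finset.sum_ite_eq', Finset.mem_univ, if_true]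
    ring
  linarith

/-- Otherwise a small amount of overload could be shifted from a higher to a lower node, which
strictly lowers the norm. The shift must be below both the residual capacity (or the flow to be
cancelled) and the difference of levels. -/
theorem IsLeastNormOverload.residual {q : N → ℝ} (hq : W.IsLeastNormOverload lam E q)
    {f : N → N → ℝ} (hf : ∀ i j, 0 ≤ f i j ∧ f i j ≤ W.cap E i j)
    (hqf : ∀ n, n ≠ W.d → q n = (if n = W.s then lam else 0) + ∑ i, f i n - ∑ j, f n j)
    (u v : N) : (q v < q u → f u v = W.cap E u v) ∧ (q u < q v → f u v = 0) := by
  have hu := hq.1.1 u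
  have hv := hq.1.1 v
  constructor
  · intro h
    by_contra hne
    have hlt := lt_of_le_of_ne (hf u v).2 hne
    have huv : u ≠ v := by rintro rfl; exact lt_irrefl _ h
    obtain ⟨e, he0, he⟩ := exists_between (lt_min (sub_pos.2 hlt) (sub_pos.2 h))
    have he1 := he.trans_le (min_le_left _ _)
    have he2 := he.trans_le (min_le_right _ _)
    have := hq.perturb hf hqf huv (e := e) (by linarith [(hf u v).1]) (by linarith)
      (by linarith) (by linarith)
    nlinarith
  · intro h
    by_contra hne
    have hlt := lt_of_le_of_ne (hf u v).1 (Ne.symm hne)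
    have huv : u ≠ v := by rintro rfl; exact lt_irrefl _ h
    obtain ⟨e, he0, he⟩ := exists_between (lt_min hlt (sub_pos.2 h))
    have he1 := he.trans_le (min_le_left _ _)
    have he2 := he.trans_le (min_le_right _ _)
    have := hq.perturb hf hqf huv (e := -e) (by linarith) (by linarith [(hf u v).2])
      (by linarith) (by linarith)
    nlinarith

/-- The links out of a level set of the least overload vector are saturated, those into it are
empty. -/
theorem IsLeastNormOverload.sum_level {q : N → ℝ} (hq : W.IsLeastNormOverload lam E q)
    {h : ℝ} (hh : 0 ≤ h) :
    W.d ∉ Finset.univ.filter (fun n => h < q n) ∧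
    ∑ n ∈ Finset.univ.filter (fun n => h < q n), q n =
      (if W.s ∈ Finset.univ.filter (fun n => h < q n) then lam else 0) -
        W.cutCap E (Finset.univ.filter (fun n => h < q n)) := by
  obtain ⟨h0, hd, f, hf, hqf⟩ := hq.1
  have hres := hq.residual hf hqf
  set Z := Finset.univ.filter (fun n => h < q n) with hZdef
  have hmem : ∀ n, n ∈ Z ↔ h < q n := by simp [Z]
  have hZ : W.d ∉ Z := by simp [hmem, hd, hh]
  refine ⟨hZ, ?_⟩
  have h1 : ∑ n ∈ Z, q n = (if W.s ∈ Z then lam else 0) + (flux f Zᶜ Z - flux f Z Zᶜ) := by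
    rw [← sum_net_eq, ← Finset.sum_ite_eq' Z W.s (fun _ => lam), ← Finset.sum_add_distrib]
    refine Finset.sum_congr rfl fun n hn => ?_
    rw [hqf n (fun h => hZ (h ▸ hn))]; ring
  have h2 : flux f Zᶜ Z = 0 := flux_eq_zero fun i hi j hj => (hres i j).2 (by
    rw [Finset.mem_compl, hmem, not_lt] at hi
    exact hi.trans_lt ((hmem j).1 hj))
  have h3 : flux f Z Zᶜ = flux (W.cap E) Z Zᶜ := flux_congr fun i hi j hj => (hres i j).1 (by
    rw [Finset.mem_compl, hmem, not_lt] at hj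
    exact hj.trans_lt ((hmem i).1 hi))
  rw [h1, h2, h3, cutCap_eq_flux]; ring

/-- The level `a` is the entry of `l` at the first difference: common entries contribute equally,
the rest of `l` lies at or below `a`, and `l'` has an entry above it. This turns a lexicographic
comparison into one of sums of excesses over a level. -/
theorem exists_sum_max_lt_of_lex {l l' : List ℝ} (hl : l.length = l'.length)
    (hs : l.Pairwise (· ≥ ·)) (h : l < l') :
    ∃ a ∈ l, (l.map fun x => max (x - a) 0).sum < (l'.map fun x => max (x - a) 0).sum := by
  induction h with
  | nil => simp at hl
  | @cons a l l' h ih =>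
    obtain ⟨b, hb, hlt⟩ := ih (by simpa using hl) (List.pairwise_cons.1 hs).2
    exact ⟨b, List.mem_cons_of_mem _ hb, by simpa using hlt⟩
  | @rel a l b l' h =>
    refine ⟨a, List.mem_cons_self, ?_⟩
    have h1 : (List.map (fun x => max (x - a) 0) (a :: l)).sum = 0 := by
      refine List.sum_eq_zero fun y hy => ?_
      obtain ⟨x, hx, rfl⟩ := List.mem_map.1 hy
      rcases List.mem_cons.1 hx with rfl | hx
      · simp
      · exact max_eq_right (sub_nonpos.2 ((List.pairwise_cons.1 hs).1 x hx))
    rw [h1, List.map_cons, List.sum_cons]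
    have h2 : 0 ≤ (List.map (fun x => max (x - a) 0) l').sum :=
      List.sum_nonneg fun y hy => by
        obtain ⟨x, _, rfl⟩ := List.mem_map.1 hy
        exact le_max_right _ _
    have h3 : 0 < max (b - a) 0 := lt_max_of_lt_left (sub_pos.2 h)
    linarith

theorem sum_map_sortedDesc (q : N → ℝ) (g : ℝ → ℝ) :
    ((sortedDesc q).map g).sum = ∑ n, g (q n) := by
  rw [sortedDesc, ← Multiset.sum_coe, ← Multiset.map_coe, Multiset.sort_eq, Multiset.map_map]
  rfl

/-- A least-norm vector minimises the total excess over every nonnegative level, because its level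
sets attain equality in `IsFeasibleOverload.le_sum`. A lexicographically smaller vector would have
less excess over some level. -/
theorem IsLeastNormOverload.isLexMinOverload {q : N → ℝ} (hq : W.IsLeastNormOverload lam E q) :
    W.IsLexMinOverload lam E q := by
  refine ⟨hq.1, fun q' hq' hlt => ?_⟩
  obtain ⟨a, ha, hlt⟩ := exists_sum_max_lt_of_lex (l := sortedDesc q')
    (by simp [sortedDesc]) (Multiset.pairwise_sort _ _) hlt
  have ha0 : 0 ≤ a := by
    simp only [sortedDesc, Multiset.mem_sort, Multiset.mem_map] at ha
    obtain ⟨n, _, rfl⟩ := ha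
    exact hq'.1 n
  rw [sum_map_sortedDesc, sum_map_sortedDesc] at hlt
  obtain ⟨hd, hsum⟩ := hq.sum_level ha0
  have h1 := hq'.le_sum hd
  set Z := Finset.univ.filter (fun n => a < q n)
  have h2 : ∑ n, max (q n - a) 0 = ∑ n ∈ Z, (q n - a) := by
    rw [Finset.sum_filter]
    refine Finset.sum_congr rfl fun n _ => ?_
    split_ifs with h
    · exact max_eq_left (by linarith)
    · exact max_eq_right (by linarith)
  have h3 : ∑ n ∈ Z, (q' n - a) ≤ ∑ n, max (q' n - a) 0 :=
    (Finset.sum_le_sum fun n _ => le_max_left _ _).trans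
      (Finset.sum_le_sum_of_subset_of_nonneg (Finset.subset_univ _) fun n _ _ => le_max_right _ _)
  rw [Finset.sum_sub_distrib] at h2 h3
  linarith

/-- Lexicographic comparison is total on sorted vectors, so the given vector has the same sorted
entries, hence the same norm, as some least-norm vector. -/
theorem IsLexMinOverload.isLeastNormOverload (hlam : 0 ≤ lam) (hE : ∀ i j, 0 ≤ W.cap E i j)
    {q : N → ℝ} (hq : W.IsLexMinOverload lam E q) : W.IsLeastNormOverload lam E q := by
  obtain ⟨p, hp⟩ := exists_isLeastNormOverload hlam hE
  have h1 := hq.2 p hp.1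
  have h2 := hp.isLexMinOverload.2 q hq.1
  have h3 : sortedDesc q = sortedDesc p := le_antisymm (not_lt.1 h1) (not_lt.1 h2)
  refine ⟨hq.1, fun q' hq' => ?_⟩
  rw [← sum_map_sortedDesc q (· ^ 2), h3, sum_map_sortedDesc]
  exact hp.2 q' hq'

/-- The overloaded nodes are the source side of the smallest min-cut. -/
theorem IsLexMinOverload.mem_iff (hE : ∀ i j, 0 ≤ W.cap E i j)
    {q : N → ℝ} (hq : W.IsLexMinOverload lam E q) {X : Finset N}
    (hX : W.IsSmallestMinCut E X) (hlam : W.cutCap E X < lam) (n : N) : n ∈ X ↔ 0 < q n := by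
  have hX0 : 0 ≤ W.cutCap E X := flux_nonneg hE _ _
  have hq' := hq.isLeastNormOverload (hX0.trans hlam.le) hE
  obtain ⟨hd, hsum⟩ := hq'.sum_level le_rfl
  have hmem : ∀ n, n ∈ Finset.univ.filter (fun n => 0 < q n) ↔ 0 < q n := by simp
  set Z := Finset.univ.filter (fun n => 0 < q n)
  have hle : ∀ Y : Finset N, ∑ n ∈ Y, q n ≤ ∑ n ∈ Z, q n := by
    intro Y
    rw [Finset.sum_filter]
    refine (Finset.sum_le_sum_of_subset_of_nonneg (Finset.subset_univ Y)
      fun n _ _ => hq.1.1 n).trans (Finset.sum_le_sum fun n _ => ?_)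
    split_ifs with h
    · exact le_rfl
    · exact not_lt.1 h
  have hXs := hq.1.le_sum hX.1.1.2
  rw [if_pos hX.1.1.1] at hXs
  have hZ0 : 0 ≤ W.cutCap E Z := flux_nonneg hE _ _
  have hs : W.s ∈ Z := by
    by_contra h
    rw [if_neg h] at hsum
    linarith [hle X]
  rw [if_pos hs] at hsum
  -- The whole overload sits in `Z` and equals `lam` minus the capacity of `Z`, while every cut
  -- forces at least `lam` minus its own capacity.
  have hmin : W.IsMinCut E Z := by
    refine ⟨⟨hs, hd⟩, fun Y hY => ?_⟩
    have := hq.1.le_sum hY.2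
    rw [if_pos hY.1] at this
    linarith [hle Y]
  have hsub := hX.subset hE hmin
  rw [← hmem]
  refine ⟨fun h => hsub h, fun h => ?_⟩
  -- A node of `Z` outside `X` would leave `X` with less than the total overload, although both cuts
  -- have the same capacity and force the same amount.
  by_contra hn
  have h1 := Finset.sum_sdiff hsub (f := q)
  have h2 : 0 < ∑ n ∈ Z \ X, q n :=
    Finset.sum_pos (fun m hm => (hmem m).1 (Finset.mem_sdiff.1 hm).1)
      ⟨n, Finset.mem_sdiff.2 ⟨h, hn⟩⟩
  have h3 := hX.1.2 Z hmin.1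
  have h4 := hmin.2 X hX.1.1
  linarith

theorem exists_isLexMinOverload (hE : ∀ i j, 0 ≤ W.cap E i j) (hlam : 0 ≤ lam) :
    ∃ q, W.IsLexMinOverload lam E q :=
  (exists_isLeastNormOverload hlam hE).imp fun _ h => h.isLexMinOverload

/-- The max-flow min-cut theorem. -/
theorem le_maxFlow_of_forall_cut (hE : ∀ i j, 0 ≤ W.cap E i j)
    (h : ∀ X, W.IsCut X → lam ≤ W.cutCap E X) : lam ≤ W.maxFlow E := by
  rcases lt_or_ge lam 0 with hlam | hlam
  · have := W.le_maxFlow W.isFlow_zero hE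
    simp only [flowValue, Finset.sum_const_zero, sub_zero] at this
    linarith
  obtain ⟨q, hq⟩ := exists_isLeastNormOverload hlam hE
  obtain ⟨hd, hsum⟩ := hq.sum_level le_rfl
  have hmem : ∀ n, n ∈ Finset.univ.filter (fun n => 0 < q n) ↔ 0 < q n := by simp
  set Z := Finset.univ.filter (fun n => 0 < q n)
  -- A nonempty support would be a cut of capacity below `lam`, or would have positive overload
  -- without any arrivals.
  have hq0 : ∀ n, q n = 0 := by
    intro n
    by_contra hn
    have hZ : 0 < ∑ n ∈ Z, q n := Finset.sum_pos (fun m hm => (hmem m).1 hm)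
      ⟨n, (hmem n).2 (lt_of_le_of_ne (hq.1.1 n) (Ne.symm hn))⟩
    have hZ0 : 0 ≤ W.cutCap E Z := flux_nonneg hE _ _
    split_ifs at hsum with hs
    · linarith [h Z ⟨hs, hd⟩]
    · linarith
  obtain ⟨_, _, f, hf, hqf⟩ := hq.1
  have hflow : W.IsFlow f := ⟨fun i j => (hf i j).1, fun n hs hd => by
    have := hqf n hd
    rw [hq0, if_neg hs] at this
    linarith⟩
  have hv : W.flowValue f = lam := by
    have := hqf W.s W.s_ne_d
    rw [hq0, if_pos rfl] at this
    unfold flowValue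
    linarith
  exact hv ▸ W.le_maxFlow hflow fun i j => (hf i j).2

theorem le_maxFlow_iff (hE : ∀ i j, 0 ≤ W.cap E i j) {X : Finset N} (hX : W.IsMinCut E X) :
    lam ≤ W.maxFlow E ↔ lam ≤ W.cutCap E X :=
  ⟨fun h => h.trans (W.maxFlow_le_cutCap hE hX.1),
    fun h => le_maxFlow_of_forall_cut hE fun Y hY => h.trans (hX.2 Y hY)⟩

end Overload

/-! ### Reversing the links of the smallest min-cut -/

/-- After the reversal no link enters `M`, so a cycle stays on one side of the boundary, where the
directions are unchanged. -/
theorem IsEmbeddedDAG.reverseMarked {W : Network N} {E : N → N → Prop} (hE : W.IsEmbeddedDAG E)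
    (M : Finset N) : W.IsEmbeddedDAG (reverseMarked M E) where
  links i j := by
    rw [hE.links i j]
    unfold Network.reverseMarked
    tauto
  one_direction i j := by
    have h1 := hE.one_direction i j
    unfold Network.reverseMarked
    tauto
  acyclic n hn := by
    have key : ∀ a b, Relation.TransGen (Network.reverseMarked M E) a b →
        (b ∈ M → a ∈ M) ∧ ((a ∈ M ↔ b ∈ M) → Relation.TransGen E a b) := by
      intro a b hab
      have hstep : ∀ x y, Network.reverseMarked M E x y →
          (y ∈ M → x ∈ M) ∧ ((x ∈ M ↔ y ∈ M) → E x y) := by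
        intro x y
        unfold Network.reverseMarked
        tauto
      induction hab with
      | single h => exact ⟨(hstep _ _ h).1, fun h' => .single ((hstep _ _ h).2 h')⟩
      | tail _ h ih =>
        have := hstep _ _ h
        refine ⟨fun h' => ih.1 (this.1 h'), fun h' => ?_⟩
        exact (ih.2 (by tauto)).tail (this.2 (by tauto))
    exact hE.acyclic n ((key n n hn).2 Iff.rfl)

theorem isEmbeddedDAG_initialDAG : W.IsEmbeddedDAG W.initialDAG where
  links i j := by
    constructor
    · intro h
      rcases lt_or_gt_of_ne (fun he => h.ne (W.ident_injective he)) with h' | h'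
      · exact Or.inl ⟨h, h'⟩
      · exact Or.inr ⟨h.symm, h'⟩
    · rintro (h | h)
      exacts [h.1, h.1.symm]
  one_direction i j h h' := lt_asymm h.2 h'.2
  acyclic n hn := by
    have key : ∀ a b, Relation.TransGen W.initialDAG a b → W.ident a < W.ident b := by
      intro a b hab
      induction hab with
      | single h => exact h.2
      | tail _ h ih => exact ih.trans h.2
    exact lt_irrefl _ (key n n hn)

/-- The smallest min-cut. -/
noncomputable def smallestMinCut (E : N → N → Prop) : Finset N := (W.exists_isSmallestMinCut E).choose

theorem isSmallestMinCut_smallestMinCut (E : N → N → Prop) :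
    W.IsSmallestMinCut E (W.smallestMinCut E) := (W.exists_isSmallestMinCut E).choose_spec

/-- Reversal of the links into the smallest min-cut. -/
def reverseStep (E : N → N → Prop) : N → N → Prop := reverseMarked (W.smallestMinCut E) E

/-- The value of the min-cut, then the size of the smallest min-cut. -/
noncomputable def cutRank (E : N → N → Prop) : Lex (ℝ × ℕ) :=
  toLex (W.cutCap E (W.smallestMinCut E), (W.smallestMinCut E).card)

/-- Let `X` and `Y` be the smallest min-cuts before and after. Submodularity bounds the new capacity
of `Y` below by the old one of `X`. In case of equality `Y ∩ X` is an old min-cut, so `X ⊆ Y`; and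
`X ≠ Y` because the new capacity of `X` is at least `lam`. -/
theorem cutRank_lt_reverseStep {lam : ℝ} (hlam : lam ≤ W.maxFlowG) {E : N → N → Prop}
    (hE : W.IsEmbeddedDAG E) (h : W.maxFlow E < lam) :
    W.cutRank E < W.cutRank (W.reverseStep E) := by
  have hX := W.isSmallestMinCut_smallestMinCut E
  have hY := W.isSmallestMinCut_smallestMinCut (W.reverseStep E)
  have hE' : W.IsEmbeddedDAG (W.reverseStep E) := hE.reverseMarked _
  rw [cutRank, cutRank, Prod.Lex.toLex_lt_toLex]
  have hlt : W.cutCap E (W.smallestMinCut E) < lam := by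
    rw [← not_le, ← le_maxFlow_iff hE.cap_nonneg hX.1]; exact not_le.2 h
  -- All links of `G` across `X` now point outwards, so `X` has its full undirected capacity.
  have hfull : lam ≤ W.cutCap (W.reverseStep E) (W.smallestMinCut E) := by
    refine hlam.trans ((W.maxFlowG_le_flux hX.1.1).trans (flux_le_flux fun i hi j hj => ?_))
    rw [Finset.mem_compl] at hj
    by_cases hij : W.G.Adj i j
    · have : W.reverseStep E i j := by
        have := (hE.links i j).1 hij
        unfold reverseStep Network.reverseMarked
        tauto
      simp [cap, hij, this]
    · simpa [cap, hij] using hE'.cap_nonneg i j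
  have hsub := W.cutCap_inter_add_union_le hE.cap_nonneg hE'.cap_nonneg
    (X := W.smallestMinCut E) (fun i j hij => by
      have : W.reverseStep E i j ↔ E i j := by
        unfold reverseStep Network.reverseMarked; tauto
      simp [cap, this]) (fun i j hi hj => by
      by_cases hij : E i j
      · have : W.reverseStep E i j := by
          unfold reverseStep Network.reverseMarked; tauto
        simp [cap, hij, this]
      · have h0 : W.cap E i j = 0 := if_neg hij
        rw [h0]; exact hE'.cap_nonneg i j) (W.smallestMinCut (W.reverseStep E))
  set X := W.smallestMinCut E
  set Y := W.smallestMinCut (W.reverseStep E)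
  have h1 := hX.1.2 _ (hX.1.1.union hY.1.1)
  have h2 := hX.1.2 _ (hX.1.1.inter hY.1.1)
  rcases lt_or_ge (W.cutCap E X) (W.cutCap (W.reverseStep E) Y) with h3 | h3
  · exact Or.inl h3
  · refine Or.inr ⟨by linarith, Finset.card_lt_card ?_⟩
    refine (hX.subset_of_inter hY.1.1 (by linarith)).ssubset_of_ne ?_
    intro he
    rw [← he] at h3
    linarith

theorem isEmbeddedDAG_iterate {E : N → N → Prop} (hE : W.IsEmbeddedDAG E) (k : ℕ) :
    W.IsEmbeddedDAG (W.reverseStep^[k] E) := by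
  induction k with
  | zero => exact hE
  | succ k ih => rw [Function.iterate_succ_apply']; exact ih.reverseMarked _

/-- A strictly increasing rank would give infinitely many distinct directed graphs on a finite set
of nodes. The initial DAG is arbitrary, so the result also applies in the middle of a run. -/
theorem exists_iterate_supports {lam : ℝ} (hlam : lam ≤ W.maxFlowG) {E : N → N → Prop}
    (hE : W.IsEmbeddedDAG E) : ∃ k, lam ≤ W.maxFlow (W.reverseStep^[k] E) := by
  by_contra! h
  have hmono : StrictMono fun k => W.cutRank (W.reverseStep^[k] E) :=
    strictMono_nat_of_lt_succ fun k => by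
      rw [Function.iterate_succ_apply']
      exact W.cutRank_lt_reverseStep hlam (W.isEmbeddedDAG_iterate hE k) (h k)
  exact not_injective_infinite_finite (fun k => W.reverseStep^[k] E) fun a b hab =>
    hmono.injective (congrArg W.cutRank hab)

end Network

namespace Network

variable {N : Type*}

/-! ### One slot of backpressure -/

/-- Serving demands `c` one after the other uses at most the available amount. -/
theorem sum_min_max_sub_le {r : N → ℕ} (hr : Function.Injective r) {c : N → ℝ}
    (hc : ∀ j, 0 ≤ c j) {x : ℝ} (hx : 0 ≤ x) (S : Finset N) :
    ∑ j ∈ S, min (c j) (max 0 (x - ∑ j' ∈ S with r j' < r j, c j')) ≤ min x (∑ j ∈ S, c j) := by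
  -- Adding the demand that is served last leaves the amounts served to the others unchanged.
  induction S using Finset.induction_on_max_value r with
  | empty => simpa using hx
  | insert a S ha hmax ih =>
    have h1 : (insert a S).filter (fun j' => r j' < r a) = S := by
      ext j
      simp only [Finset.mem_filter, Finset.mem_insert]
      refine ⟨fun h => h.1.resolve_left fun h' => by simp [h'] at h, fun h => ⟨Or.inr h, ?_⟩⟩
      exact lt_of_le_of_ne (hmax j h) fun h' => ha (hr h' ▸ h)
    have h2 : ∀ j ∈ S, (insert a S).filter (fun j' => r j' < r j) =
        S.filter (fun j' => r j' < r j) := by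
      intro j hj
      rw [Finset.filter_insert, if_neg (not_lt.2 (hmax j hj))]
    have h3 : ∑ j ∈ S, min (c j) (max 0 (x - ∑ j' ∈ insert a S with r j' < r j, c j')) =
        ∑ j ∈ S, min (c j) (max 0 (x - ∑ j' ∈ S with r j' < r j, c j')) :=
      Finset.sum_congr rfl fun j hj => by rw [h2 j hj]
    rw [Finset.sum_insert ha, Finset.sum_insert ha, h1, h3]
    have ha0 := hc a
    have ih1 := ih.trans (min_le_left _ _)
    have ih2 := ih.trans (min_le_right _ _)
    rcases le_total (∑ j ∈ S, c j) x with h | h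
    · rw [max_eq_right (sub_nonneg.2 h)]
      have h3 := min_le_left (c a) (x - ∑ j ∈ S, c j)
      have h4 := min_le_right (c a) (x - ∑ j ∈ S, c j)
      exact le_min (by linarith) (by linarith)
    · rw [max_eq_left (sub_nonpos.2 h), min_eq_right ha0]
      exact le_min (by linarith) (by linarith)

variable [Fintype N] (W : Network N)

/-- A bound for the total capacity of a directed graph. -/
noncomputable def totalCap : ℝ := ∑ i, ∑ j, |W.c s(i, j)|

theorem totalCap_nonneg : 0 ≤ W.totalCap :=
  Finset.sum_nonneg fun _ _ => Finset.sum_nonneg fun _ _ => abs_nonneg _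

theorem flux_le_totalCap {f : N → N → ℝ} {E : N → N → Prop} (h : ∀ i j, f i j ≤ W.cap E i j)
    (A B : Finset N) : flux f A B ≤ W.totalCap := by
  refine (flux_le_flux fun i _ j _ => ?_).trans (flux_mono (f := fun i j => |W.c s(i, j)|)
    (fun i j => abs_nonneg _) (Finset.subset_univ A) (Finset.subset_univ B))
  refine (h i j).trans ?_
  unfold cap
  split_ifs
  exacts [le_abs_self _, abs_nonneg _]

theorem sum_cap_le_totalCap (E : N → N → Prop) (i : N) : ∑ j, W.cap E i j ≤ W.totalCap := by
  have := W.flux_le_totalCap (E := E) (fun _ _ => le_rfl) {i} Finset.univ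
  simpa [flux] using this

variable {W} {E : N → N → Prop}

theorem bpTransmit_nonneg (hE : ∀ i j, 0 ≤ W.cap E i j) (rank : N → N → ℕ) (Q : N → ℝ)
    (i j : N) : 0 ≤ W.bpTransmit rank E Q i j := by
  unfold bpTransmit
  split_ifs
  exacts [le_min (hE i j) (le_max_left _ _), le_rfl]

theorem bpTransmit_le_cap (hE : ∀ i j, 0 ≤ W.cap E i j) (rank : N → N → ℕ) (Q : N → ℝ)
    (i j : N) : W.bpTransmit rank E Q i j ≤ W.cap E i j := by
  unfold bpTransmit
  split_ifs
  exacts [min_le_left _ _, hE i j]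

theorem bpTransmit_eq_zero (rank : N → N → ℕ) {Q : N → ℝ} {i j : N} (h : Q i ≤ Q j) :
    W.bpTransmit rank E Q i j = 0 :=
  if_neg fun h' => not_lt.2 h h'.2

/-- With at least `totalCap` in store, a node can serve all of its outgoing links fully, whatever
the order of service. -/
theorem bpTransmit_eq_cap (hE : ∀ i j, 0 ≤ W.cap E i j) (rank : N → N → ℕ) {Q : N → ℝ} {i j : N}
    (h : Q j < Q i) (hi : W.totalCap ≤ Q i) : W.bpTransmit rank E Q i j = W.cap E i j := by
  unfold bpTransmit
  split_ifs with h'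
  · refine min_eq_left (le_max_of_le_right ?_)
    have h1 : W.cap E i j + ∑ j' with E i j' ∧ Q j' < Q i ∧ rank i j' < rank i j, W.cap E i j'
        ≤ ∑ j', W.cap E i j' := by
      rw [← Finset.sum_insert (by simp)]
      exact Finset.sum_le_sum_of_subset_of_nonneg (Finset.subset_univ _) fun j' _ _ => hE i j'
    linarith [W.sum_cap_le_totalCap E i]
  · exact (if_neg fun hij => h' ⟨hij, h⟩).symm

theorem sum_bpTransmit_le (hE : ∀ i j, 0 ≤ W.cap E i j) {rank : N → N → ℕ} {i : N}
    (hr : Function.Injective (rank i)) {Q : N → ℝ} (hQ : 0 ≤ Q i) :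
    ∑ j, W.bpTransmit rank E Q i j ≤ Q i := by
  have h := (sum_min_max_sub_le hr (hE i) hQ
    (Finset.univ.filter fun j => E i j ∧ Q j < Q i)).trans (min_le_left _ _)
  rw [Finset.sum_filter] at h
  simpa only [bpTransmit, Finset.filter_filter, and_assoc] using h

theorem bpStep_nonneg (hE : ∀ i j, 0 ≤ W.cap E i j) {rank : N → N → ℕ}
    (hr : ∀ i, Function.Injective (rank i)) {Q : N → ℝ} (hQ : ∀ n, 0 ≤ Q n) {a : ℝ} (ha : 0 ≤ a)
    (n : N) : 0 ≤ W.bpStep rank E a Q n := by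
  unfold bpStep
  have h1 := sum_bpTransmit_le hE (hr n) (hQ n)
  have h2 : 0 ≤ ∑ i, W.bpTransmit rank E Q i n :=
    Finset.sum_nonneg fun i _ => bpTransmit_nonneg hE rank Q i n
  split_ifs <;> linarith

theorem sum_bpStep (rank : N → N → ℕ) (Q : N → ℝ) (a : ℝ) {Z : Finset N} (hZ : W.d ∉ Z) :
    ∑ n ∈ Z, W.bpStep rank E a Q n = ∑ n ∈ Z, Q n + (if W.s ∈ Z then a else 0) +
      (flux (W.bpTransmit rank E Q) Zᶜ Z - flux (W.bpTransmit rank E Q) Z Zᶜ) := by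
  rw [← sum_net_eq, ← Finset.sum_ite_eq' Z W.s (fun _ => a), ← Finset.sum_add_distrib,
    ← Finset.sum_add_distrib]
  refine Finset.sum_congr rfl fun n hn => ?_
  rw [bpStep, if_neg fun h : n = W.d => hZ (h ▸ hn)]
  ring

theorem sum_univ_bpStep_le (hE : ∀ i j, 0 ≤ W.cap E i j) (rank : N → N → ℕ) {Q : N → ℝ}
    (hQ : ∀ n, 0 ≤ Q n) (hd : Q W.d = 0) (a : ℝ) :
    ∑ n, W.bpStep rank E a Q n ≤ ∑ n, Q n + a := by
  have h := sum_bpStep (W := W) (E := E) rank Q a (Z := {W.d}ᶜ) (by simp)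
  have h1 : flux (W.bpTransmit rank E Q) {W.d}ᶜᶜ {W.d}ᶜ = 0 := flux_eq_zero fun i hi j _ => by
    rw [compl_compl, Finset.mem_singleton] at hi
    exact bpTransmit_eq_zero rank (by rw [hi, hd]; exact hQ j)
  have h2 := flux_nonneg (bpTransmit_nonneg hE rank Q) {W.d}ᶜ {W.d}ᶜᶜ
  have h3 : W.bpStep rank E a Q W.d = 0 := if_pos rfl
  have h4 := Finset.sum_add_sum_compl {W.d} (W.bpStep rank E a Q)
  have h5 := Finset.sum_add_sum_compl {W.d} Q
  rw [Finset.sum_singleton] at h4 h5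
  rw [if_pos (by simpa using W.s_ne_d)] at h
  linarith

/-- Nodes outside a min-cut whose backlogs are above those of the other such nodes drain at least
as fast as they are filled. -/
theorem sum_bpStep_le_of_above (hE : ∀ i j, 0 ≤ W.cap E i j) {X : Finset N}
    (hX : W.IsMinCut E X) (rank : N → N → ℕ) {Q : N → ℝ} (a : ℝ) {S : Finset N}
    (hS : Disjoint X S) (hd : W.d ∉ S)
    (hsep : ∀ i ∈ S, ∀ j, j ∉ X → j ∉ S → Q j < Q i) (hbig : ∀ i ∈ S, W.totalCap ≤ Q i) :
    ∑ n ∈ S, W.bpStep rank E a Q n ≤ ∑ n ∈ S, Q n := by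
  have hXS : X ⊆ Sᶜ := Finset.subset_compl_iff_disjoint_right.2 hS
  rw [sum_bpStep rank Q a hd, if_neg (Finset.mem_compl.1 (hXS hX.1.1)),
    flux_split_left _ hXS, flux_split_right _ S hXS]
  have h1 : flux (W.bpTransmit rank E Q) (Sᶜ \ X) S = 0 := flux_eq_zero fun i hi j hj => by
    simp only [Finset.mem_sdiff, Finset.mem_compl] at hi
    exact bpTransmit_eq_zero rank (hsep j hj i hi.2 hi.1).le
  have h2 : flux (W.bpTransmit rank E Q) S (Sᶜ \ X) = flux (W.cap E) S (Sᶜ \ X) :=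
    flux_congr fun i hi j hj => by
      simp only [Finset.mem_sdiff, Finset.mem_compl] at hj
      exact bpTransmit_eq_cap hE rank (hsep i hi j hj.2 hj.1) (hbig i hi)
  have h3 := flux_nonneg (bpTransmit_nonneg hE rank Q) S X
  have h4 : flux (W.bpTransmit rank E Q) X S ≤ flux (W.cap E) X S :=
    flux_le_flux fun i _ j _ => bpTransmit_le_cap hE rank Q i j
  -- Minimality of `X` against `X ∪ S` says that the capacity from `X` into `S` is at most that from
  -- `S` to the remaining nodes.
  have h5 : W.cutCap E (X ∪ S) + flux (W.cap E) X S =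
      W.cutCap E X + flux (W.cap E) S (Sᶜ \ X) := by
    simp only [cutCap_eq, flux_eq, ← Finset.sum_add_distrib]
    refine Finset.sum_congr rfl fun i _ => Finset.sum_congr rfl fun j _ => ?_
    have hi : i ∈ X → i ∉ S := fun h => Finset.disjoint_left.1 hS h
    have hj : j ∈ X → j ∉ S := fun h => Finset.disjoint_left.1 hS h
    simp only [Finset.mem_union, Finset.mem_sdiff, Finset.mem_compl]
    by_cases hiX : i ∈ X <;> by_cases hjX : j ∈ X <;> by_cases hiS : i ∈ S <;>
      by_cases hjS : j ∈ S <;> simp_all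
  have h6 := hX.2 (X ∪ S) ⟨Finset.mem_union_left _ hX.1.1,
    fun h => (Finset.mem_union.1 h).elim hX.1.2 hd⟩
  linarith

/-- Nodes of a cut whose backlogs are below those of the other such nodes are filled at least at
the capacity from those nodes. -/
theorem le_sum_bpStep_of_below (hE : ∀ i j, 0 ≤ W.cap E i j) {X : Finset N}
    (hX : W.IsCut X) (rank : N → N → ℕ) {Q : N → ℝ} (a : ℝ) {Z : Finset N} (hZ : Z ⊆ X)
    (hsep : ∀ i ∈ Z, ∀ j ∈ X, j ∉ Z → Q i < Q j)
    (hbig : ∀ j ∈ X, j ∉ Z → W.totalCap ≤ Q j) :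
    ∑ n ∈ Z, Q n + (if W.s ∈ Z then a else 0) +
      (flux (W.cap E) (X \ Z) Z - flux (W.cap E) Z Xᶜ) ≤ ∑ n ∈ Z, W.bpStep rank E a Q n := by
  have hsub : X \ Z ⊆ Zᶜ := fun n hn => Finset.mem_compl.2 (Finset.mem_sdiff.1 hn).2
  rw [sum_bpStep rank Q a (fun h => hX.2 (hZ h)), flux_split_right _ Z hsub]
  have h1 : flux (W.cap E) (X \ Z) Z ≤ flux (W.bpTransmit rank E Q) Zᶜ Z := by
    refine le_trans (le_of_eq (flux_congr fun i hi j hj => ?_))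
      (flux_mono (bpTransmit_nonneg hE rank Q) hsub subset_rfl)
    rw [Finset.mem_sdiff] at hi
    exact (bpTransmit_eq_cap hE rank (hsep j hj i hi.1 hi.2) (hbig i hi.1 hi.2)).symm
  have h2 : flux (W.bpTransmit rank E Q) Z (X \ Z) = 0 := flux_eq_zero fun i hi j hj => by
    rw [Finset.mem_sdiff] at hj
    exact bpTransmit_eq_zero rank (hsep i hi j hj.1 hj.2).le
  have h3 : flux (W.bpTransmit rank E Q) Z (Zᶜ \ (X \ Z)) ≤ flux (W.cap E) Z Xᶜ := by
    refine (flux_le_flux fun i _ j _ => bpTransmit_le_cap hE rank Q i j).trans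
      (flux_mono hE subset_rfl fun n hn => ?_)
    simp only [Finset.mem_sdiff, Finset.mem_compl] at hn ⊢
    tauto
  linarith

/-! ### Queues under backpressure -/

variable {rank : ℕ → N → N → ℕ} {A : ℕ → ℝ} {Q : N → ℝ}

theorem bpQueue_nonneg (hE : ∀ i j, 0 ≤ W.cap E i j) (hr : ∀ t i, Function.Injective (rank t i))
    (hA : ∀ t, 0 ≤ A t) (t : ℕ) (hQ : ∀ n, 0 ≤ Q n) (τ : ℕ) (n : N) :
    0 ≤ W.bpQueue rank A E t Q τ n := by
  induction τ generalizing n with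
  | zero => exact hQ n
  | succ τ ih => exact bpStep_nonneg hE (hr _) ih (hA _) n

theorem bpQueue_dest (t : ℕ) (hd : Q W.d = 0) (τ : ℕ) : W.bpQueue rank A E t Q τ W.d = 0 := by
  cases τ with
  | zero => exact hd
  | succ τ => exact if_pos rfl

theorem sum_bpQueue_le (hE : ∀ i j, 0 ≤ W.cap E i j) (hr : ∀ t i, Function.Injective (rank t i))
    (hA : ∀ t, 0 ≤ A t) (t : ℕ) (hQ : ∀ n, 0 ≤ Q n) (hd : Q W.d = 0) (τ : ℕ) :
    ∑ n, W.bpQueue rank A E t Q τ n ≤ ∑ n, Q n + ∑ i ∈ Finset.range τ, A (t + i) := by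
  induction τ with
  | zero => simp [bpQueue]
  | succ τ ih =>
    have := sum_univ_bpStep_le hE (rank (t + τ)) (bpQueue_nonneg hE hr hA t hQ τ)
      (bpQueue_dest t hd τ) (A (t + τ))
    rw [Finset.sum_range_succ]
    exact this.trans (by linarith)

/-! ### Bounded backlogs outside a min-cut. -/

variable (W) in
/-- A bound for the backlogs outside the min-cut when the initial backlogs are `Q`. -/
noncomputable def backlogBound (Q : N → ℝ) : ℝ :=
  ∑ n, Q n + (2 * W.totalCap + 1) * (2 * Fintype.card N)

/-- Backlogs outside a min-cut are bounded, whatever the arrivals. -/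
theorem bpQueue_le_backlogBound (hE : ∀ i j, 0 ≤ W.cap E i j) {X : Finset N}
    (hX : W.IsMinCut E X) (t : ℕ) (hQ : ∀ n, 0 ≤ Q n) (hd : Q W.d = 0) (τ : ℕ) {n : N}
    (hn : n ∉ X) : W.bpQueue rank A E t Q τ n ≤ W.backlogBound Q := by
  set C := W.totalCap with hC
  have hC0 : 0 ≤ C := W.totalCap_nonneg
  set V := ∑ n, Q n
  set k := (Fintype.card N : ℝ) with hk
  have hV : 0 ≤ V := Finset.sum_nonneg fun n _ => hQ n
  have hcard : ∀ S : Finset N, (S.card : ℝ) ≤ k := fun S => by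
    rw [hk]; exact_mod_cast Finset.card_le_univ S
  -- The bound is concave in the size of `S`. Its increments drop by `2 * (2 * C + 1)` per added
  -- node, which exceeds the error `2 * C` made when a nearly tight set is compared with the sets
  -- having one node less or more.
  have key : ∀ S : Finset N, Disjoint X S → W.d ∉ S → ∑ n ∈ S, W.bpQueue rank A E t Q τ n ≤
      V + (2 * C + 1) * (S.card * (2 * k - S.card)) := by
    induction τ with
    | zero =>
      intro S _ _
      have h1 : ∑ n ∈ S, Q n ≤ V :=
        Finset.sum_le_sum_of_subset_of_nonneg (Finset.subset_univ _) fun n _ _ => hQ n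
      have h2 : (0 : ℝ) ≤ S.card * (2 * k - S.card) :=
        mul_nonneg (Nat.cast_nonneg _) (by linarith [hcard S, (Nat.cast_nonneg S.card : (0:ℝ) ≤ _)])
      have h3 : 0 ≤ (2 * C + 1) * (S.card * (2 * k - S.card)) := by positivity
      exact h1.trans (by linarith)
    | succ τ ih =>
      intro S hS hdS
      set q := W.bpQueue rank A E t Q τ
      have hqd : q W.d = 0 := bpQueue_dest t hd τ
      change ∑ n ∈ S, W.bpStep (rank (t + τ)) E (A (t + τ)) q n ≤ _
      set m := (S.card : ℝ) with hm
      have hmk : m ≤ k := hcard S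
      -- With room for `C` one slot cannot break the bound. Otherwise the bound is nearly tight for
      -- `S`, which forces every node of `S` above all other nodes outside `X`.
      by_cases hcase : ∑ n ∈ S, q n + C ≤ V + (2 * C + 1) * (m * (2 * k - m))
      · have hs : W.s ∉ S := Finset.disjoint_left.1 hS hX.1.1
        have h1 := W.flux_le_totalCap (bpTransmit_le_cap hE (rank (t + τ)) q) Sᶜ S
        have h2 := flux_nonneg (bpTransmit_nonneg hE (rank (t + τ)) q) S Sᶜ
        rw [sum_bpStep _ _ _ hdS, if_neg hs]
        linarith
      have hhigh : ∀ i ∈ S, (2 * C + 1) * (2 * k - 2 * m + 1) - C < q i := by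
        intro i hi
        have h1 := ih (S.erase i) (hS.mono_right (Finset.erase_subset _ _))
          fun h => hdS (Finset.mem_of_mem_erase h)
        have h2 := Finset.add_sum_erase S q hi
        have h3 : ((S.erase i).card : ℝ) = m - 1 := by
          rw [hm, ← Finset.card_erase_add_one hi]; simp
        rw [h3] at h1
        linarith
      have hbig : ∀ i ∈ S, C < q i := fun i hi => by
        have := hhigh i hi
        nlinarith
      refine (sum_bpStep_le_of_above hE hX _ _ hS hdS (fun i hi j hjX hjS => ?_)
        fun i hi => (hbig i hi).le).trans (ih S hS hdS)
      by_cases hj : j = W.d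
      · rw [hj, hqd]; exact hC0.trans_lt (hbig i hi)
      have h1 := ih (insert j S) (Finset.disjoint_insert_right.2 ⟨hjX, hS⟩)
        fun h => (Finset.mem_insert.1 h).elim (fun h => hj h.symm) hdS
      rw [Finset.sum_insert hjS, Finset.card_insert_of_notMem hjS] at h1
      push_cast at h1
      rw [← hm] at h1
      have h2 := hhigh i hi
      linarith
  unfold backlogBound
  have hk0 : 0 ≤ k := Nat.cast_nonneg _
  by_cases hnd : n = W.d
  · rw [hnd, bpQueue_dest t hd τ]; positivity
  have := key {n} (by simpa using hn) (by simpa using Ne.symm hnd)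
  rw [Finset.sum_singleton, Finset.card_singleton, Nat.cast_one] at this
  refine this.trans ?_
  nlinarith

/-! ### Growing backlogs inside the smallest min-cut. -/

/-- The rates at which sets of overloaded nodes fill up are bounded away from zero. -/
theorem IsSmallestMinCut.exists_pos_le {lam : ℝ} (hE : ∀ i j, 0 ≤ W.cap E i j) {X : Finset N}
    (hX : W.IsSmallestMinCut E X) (hlam : W.cutCap E X < lam) :
    ∃ δ > 0, ∀ Z ⊆ X, Z.Nonempty → δ ≤ (if W.s ∈ Z then lam else 0) +
      (flux (W.cap E) (X \ Z) Z - flux (W.cap E) Z Xᶜ) := by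
  obtain ⟨Z, hZ, hmin⟩ := Finset.exists_min_image (X.powerset.filter Finset.Nonempty)
    (fun Z => (if W.s ∈ Z then lam else 0) +
      (flux (W.cap E) (X \ Z) Z - flux (W.cap E) Z Xᶜ))
    ⟨X, by simpa using ⟨_, hX.1.1.1⟩⟩
  refine ⟨_, ?_, fun Z' hZ' hne => hmin Z' (by simpa using ⟨hZ', hne⟩)⟩
  simp only [Finset.mem_filter, Finset.mem_powerset] at hZ
  obtain ⟨hZX, z, hz⟩ := hZ
  -- With the source in `Z`, the rate is at least `lam` minus the min-cut capacity. Without it, `X \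
  -- Z` is a cut with fewer nodes than the smallest min-cut, so its capacity is strictly larger.
  split_ifs with hs
  · have h1 := flux_nonneg hE (X \ Z) Z
    have h2 : flux (W.cap E) Z Xᶜ ≤ W.cutCap E X := flux_mono hE hZX subset_rfl
    linarith
  · have hcut : W.IsCut (X \ Z) :=
      ⟨Finset.mem_sdiff.2 ⟨hX.1.1.1, hs⟩, fun h => hX.1.1.2 (Finset.mem_sdiff.1 h).1⟩
    have h1 : W.cutCap E X < W.cutCap E (X \ Z) := by
      by_contra! h
      have := hX.subset_of_inter hcut
        (by rwa [Finset.inter_eq_left.2 Finset.sdiff_subset]) (hZX hz)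
      exact (Finset.mem_sdiff.1 this).2 hz
    have h2 : W.cutCap E (X \ Z) + flux (W.cap E) Z Xᶜ =
        W.cutCap E X + flux (W.cap E) (X \ Z) Z := by
      simp only [cutCap_eq, flux_eq, ← Finset.sum_add_distrib]
      refine Finset.sum_congr rfl fun i _ => Finset.sum_congr rfl fun j _ => ?_
      have hi := @hZX i
      have hj := @hZX j
      simp only [Finset.mem_sdiff, Finset.mem_compl]
      by_cases hiX : i ∈ X <;> by_cases hjX : j ∈ X <;> by_cases hiS : i ∈ Z <;>
        by_cases hjS : j ∈ Z <;> simp_all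
    linarith

/-- Linear lower bounds for the backlogs of all sets of overloaded nodes persist; `er` is the
surplus of the arrivals over the rate `lam`. -/
theorem overload_bound_step {lam : ℝ} (hE : ∀ i j, 0 ≤ W.cap E i j) {X : Finset N}
    (hX : W.IsCut X) (hlam : 0 ≤ lam) {δ θ : ℝ} (hθ : 0 < θ)
    (hδ : ∀ Z ⊆ X, Z.Nonempty → δ ≤ (if W.s ∈ Z then lam else 0) +
      (flux (W.cap E) (X \ Z) Z - flux (W.cap E) Z Xᶜ))
    (hθδ : θ * (Fintype.card N : ℝ) ^ 2 ≤ δ) (rank : N → N → ℕ) {a er x M : ℝ}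
    (hM : 0 ≤ M) (hx : 2 * (W.totalCap + δ) ≤ θ * x) (her : |er| ≤ θ / 2 * x)
    (hinv : ∀ Z ⊆ X, θ * (Z.card : ℝ) ^ 2 * x - M ≤ ∑ n ∈ Z, Q n - if W.s ∈ Z then er else 0)
    {Z : Finset N} (hZ : Z ⊆ X) :
    θ * (Z.card : ℝ) ^ 2 * (x + 1) - M ≤
      ∑ n ∈ Z, W.bpStep rank E a Q n - if W.s ∈ Z then er + a - lam else 0 := by
  set C := W.totalCap with hC
  have hC0 : 0 ≤ C := W.totalCap_nonneg
  rcases Z.eq_empty_or_nonempty with rfl | hne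
  · simpa using hM
  set m := (Z.card : ℝ) with hm
  have hm1 : 1 ≤ m := by rw [hm]; exact_mod_cast hne.card_pos
  have hmk : m ≤ (Fintype.card N : ℝ) := by rw [hm]; exact_mod_cast Finset.card_le_univ Z
  have hgrow : θ * m ^ 2 ≤ δ := le_trans (by gcongr) hθδ
  have hδ0 : 0 ≤ δ := le_trans (by positivity) hgrow
  have hite : (if W.s ∈ Z then er + a - lam else 0) = (if W.s ∈ Z then er else 0) +
      (if W.s ∈ Z then a else 0) - (if W.s ∈ Z then lam else 0) := by split_ifs <;> ring
  have hl0 : 0 ≤ if W.s ∈ Z then lam else 0 := by split_ifs <;> [exact hlam; exact le_rfl]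
  rw [hite]
  -- With a margin of `C + δ`, one slot loses at most `C` while the bound rises by at most `δ`.
  -- Otherwise convexity in the size separates `Z` from the rest of `X`: the increments differ by `2
  -- * θ * x`, of which `θ * x` absorbs the arrival errors and `θ * x ≥ 2 * (C + δ)` the slack.
  by_cases hcase : θ * m ^ 2 * x - M + (C + δ) ≤ ∑ n ∈ Z, Q n - if W.s ∈ Z then er else 0
  · rw [sum_bpStep rank Q a (fun h => hX.2 (hZ h))]
    have h1 := W.flux_le_totalCap (bpTransmit_le_cap hE rank Q) Z Zᶜ
    have h2 := flux_nonneg (bpTransmit_nonneg hE rank Q) Zᶜ Z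
    linarith
  have hlow : ∀ i ∈ Z, Q i < θ * (2 * m - 1) * x + (C + δ) + θ / 2 * x := by
    intro i hi
    have h1 := hinv (Z.erase i) ((Finset.erase_subset _ _).trans hZ)
    have h2 := Finset.add_sum_erase Z Q hi
    have h3 : ((Z.erase i).card : ℝ) = m - 1 := by
      rw [hm, ← Finset.card_erase_add_one hi]; simp
    have h4 : (if W.s ∈ Z then er else 0) - (if W.s ∈ Z.erase i then er else 0) ≤ |er| := by
      have := neg_abs_le er
      have := le_abs_self er
      have := abs_nonneg er
      split_ifs <;> linarith
    rw [h3] at h1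
    linarith
  have hhigh : ∀ j ∈ X, j ∉ Z → θ * (2 * m + 1) * x - (C + δ) - θ / 2 * x < Q j := by
    intro j hj hjZ
    have h1 := hinv (insert j Z) (Finset.insert_subset hj hZ)
    rw [Finset.sum_insert hjZ, Finset.card_insert_of_notMem hjZ] at h1
    push_cast at h1
    rw [← hm] at h1
    have h4 : (if W.s ∈ Z then er else 0) - (if W.s ∈ insert j Z then er else 0) ≤ |er| := by
      have := neg_abs_le er
      have := le_abs_self er
      have := abs_nonneg er
      split_ifs <;> linarith
    linarith
  have h1 := le_sum_bpStep_of_below (Q := Q) hE hX rank a hZ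
    (fun i hi j hj hjZ => by linarith [hlow i hi, hhigh j hj hjZ])
    (fun j hj hjZ => by
      have h1 := hhigh j hj hjZ
      have h2 : 0 ≤ (m - 1) * (θ * x) := mul_nonneg (by linarith) (by linarith)
      linarith)
  have h2 := hδ Z hZ hne
  have h3 := hinv Z hZ
  rw [← hm] at h3
  linarith

/-- The backlogs of all nodes of the smallest min-cut exceed every threshold, after a time that
depends only on the rate of convergence of the average arrivals. -/
theorem IsSmallestMinCut.exists_overload_time {lam : ℝ} (hE : ∀ i j, 0 ≤ W.cap E i j)
    {X : Finset N} (hX : W.IsSmallestMinCut E X) (hlam : W.cutCap E X < lam) :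
    ∃ η > 0, ∀ (T₀ : ℕ) (R : ℝ), ∃ T₁ : ℕ, ∀ (rank : ℕ → N → N → ℕ) (A : ℕ → ℝ) (t : ℕ)
      (Q : N → ℝ), (∀ t i, Function.Injective (rank t i)) → (∀ t, 0 ≤ A t) → (∀ n, 0 ≤ Q n) →
      (∀ τ ≥ T₀, |∑ i ∈ Finset.range τ, A (t + i) - lam * τ| ≤ η * τ) →
      ∀ n ∈ X, ∃ τ < T₁, R < W.bpQueue rank A E t Q τ n := by
  obtain ⟨δ, hδ0, hδ⟩ := hX.exists_pos_le hE hlam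
  have hlam0 : 0 ≤ lam := (flux_nonneg hE X Xᶜ).trans hlam.le
  have hk : 0 < (Fintype.card N : ℝ) := by exact_mod_cast Fintype.card_pos_iff.2 ⟨W.s⟩
  set θ := δ / (Fintype.card N : ℝ) ^ 2 with hθdef
  have hθ : 0 < θ := by positivity
  have hθδ : θ * (Fintype.card N : ℝ) ^ 2 = δ := by rw [hθdef]; field_simp
  refine ⟨θ / 2, by positivity, fun T₀ R => ?_⟩
  obtain ⟨t₁, ht₁⟩ := exists_nat_ge (2 * (W.totalCap + δ) / θ)
  set t₂ := max T₀ t₁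
  -- Chosen so that the bounds hold trivially at time `t₂`, when nothing but nonnegativity of the
  -- backlogs is known.
  set M := (δ + θ / 2) * t₂ with hMdef
  have hM : 0 ≤ M := by positivity
  -- For a single node the bound has slope `θ`, of which `θ / 2` remains after the arrival error.
  obtain ⟨t₃, ht₃⟩ := exists_nat_gt ((R + M) / (θ / 2))
  refine ⟨max t₂ t₃ + 1, fun rank A t Q hr hA hQ hconv n hn => ?_⟩
  have key : ∀ τ ≥ t₂, ∀ Z ⊆ X, θ * (Z.card : ℝ) ^ 2 * τ - M ≤
      ∑ n ∈ Z, W.bpQueue rank A E t Q τ n -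
        if W.s ∈ Z then ∑ i ∈ Finset.range τ, A (t + i) - lam * τ else 0 := by
    intro τ hτ
    induction τ, hτ using Nat.le_induction with
    | base =>
      intro Z _
      have h1 : 0 ≤ ∑ n ∈ Z, W.bpQueue rank A E t Q t₂ n :=
        Finset.sum_nonneg fun n _ => bpQueue_nonneg hE hr hA t hQ t₂ n
      have h2 := hconv t₂ (le_max_left _ _)
      have h3 : (if W.s ∈ Z then ∑ i ∈ Finset.range t₂, A (t + i) - lam * t₂ else 0) ≤
          θ / 2 * t₂ := by
        split_ifs
        · exact (le_abs_self _).trans h2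
        · positivity
      have h4 : θ * (Z.card : ℝ) ^ 2 ≤ δ := by
        rw [← hθδ]
        have : (Z.card : ℝ) ≤ Fintype.card N := by exact_mod_cast Finset.card_le_univ Z
        gcongr
      have h5 : θ * (Z.card : ℝ) ^ 2 * t₂ ≤ δ * t₂ := by gcongr
      rw [hMdef]
      linarith
    | succ τ hτ ih =>
      intro Z hZ
      have hx : 2 * (W.totalCap + δ) ≤ θ * τ := by
        rw [div_le_iff₀ hθ] at ht₁
        have : (t₁ : ℝ) ≤ τ := by exact_mod_cast (le_max_right _ _).trans hτ
        nlinarith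
      have := overload_bound_step hE hX.1.1 hlam0 hθ hδ hθδ.le (rank (t + τ)) (a := A (t + τ)) hM hx
        (hconv τ ((le_max_left _ _).trans hτ)) ih hZ
      rw [Finset.sum_range_succ]
      push_cast
      refine this.trans (le_of_eq ?_)
      congr 2
      ring
  refine ⟨max t₂ t₃, Nat.lt_succ_self _, ?_⟩
  set τ := max t₂ t₃
  have h1 := key τ (le_max_left _ _) {n} (by simpa using hn)
  have h2 := hconv τ ((le_max_left _ _).trans (le_max_left _ _))
  have h3 : -(θ / 2 * τ) ≤
      if W.s ∈ ({n} : Finset N) then ∑ i ∈ Finset.range τ, A (t + i) - lam * τ else 0 := by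
    split_ifs
    · exact (abs_le.1 h2).1
    · have : 0 ≤ θ / 2 * τ := by positivity
      linarith
  rw [Finset.sum_singleton, Finset.card_singleton] at h1
  rw [div_lt_iff₀ (by positivity)] at ht₃
  have h4 : (t₃ : ℝ) ≤ τ := by exact_mod_cast le_max_right _ _
  have h5 : (t₃ : ℝ) * (θ / 2) ≤ τ * (θ / 2) := by gcongr
  push_cast at h1
  linarith

end Network

namespace Network

variable {N : Type*} [Fintype N] (W : Network N)

/-! ### Iterations of LFBP -/

/-- A uniform length of the iterations after which exactly the nodes of the smallest min-cut are
marked. -/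
theorem exists_marked_eq (lam : ℝ) : ∃ η > 0, ∃ T₁ : ℕ → ℝ → ℕ, ∀ (T₀ : ℕ) (R : ℝ)
    (E : N → N → Prop), W.IsEmbeddedDAG E → W.maxFlow E < lam →
    ∀ (rank : ℕ → N → N → ℕ) (A : ℕ → ℝ) (t : ℕ) (Q : N → ℝ),
      (∀ t i, Function.Injective (rank t i)) → (∀ t, 0 ≤ A t) → (∀ n, 0 ≤ Q n) → Q W.d = 0 →
      (∀ τ ≥ T₀, |∑ i ∈ Finset.range τ, A (t + i) - lam * τ| ≤ η * τ) →
      W.backlogBound Q ≤ R → ∀ T ≥ T₁ T₀ R, W.marked rank A E t Q T R = W.smallestMinCut E := by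
  have hone : ∀ E : N → N → Prop, ∃ η > 0, ∀ (T₀ : ℕ) (R : ℝ), ∃ T₁ : ℕ,
      W.IsEmbeddedDAG E → W.maxFlow E < lam →
      ∀ (rank : ℕ → N → N → ℕ) (A : ℕ → ℝ) (t : ℕ) (Q : N → ℝ),
        (∀ t i, Function.Injective (rank t i)) → (∀ t, 0 ≤ A t) → (∀ n, 0 ≤ Q n) →
        (∀ τ ≥ T₀, |∑ i ∈ Finset.range τ, A (t + i) - lam * τ| ≤ η * τ) →
        ∀ n ∈ W.smallestMinCut E, ∃ τ < T₁, R < W.bpQueue rank A E t Q τ n := by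
    intro E
    by_cases h : W.IsEmbeddedDAG E ∧ W.maxFlow E < lam
    · have hX := W.isSmallestMinCut_smallestMinCut E
      have hlt : W.cutCap E (W.smallestMinCut E) < lam := by
        rw [← not_le, ← le_maxFlow_iff h.1.cap_nonneg hX.1]; exact not_le.2 h.2
      obtain ⟨η, hη, H⟩ := hX.exists_overload_time h.1.cap_nonneg hlt
      exact ⟨η, hη, fun T₀ R => (H T₀ R).imp fun _ h _ _ => h⟩
    · exact ⟨1, one_pos, fun _ _ => ⟨0, fun h1 h2 => absurd ⟨h1, h2⟩ h⟩⟩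
  choose η hη T₁ hT₁ using hone
  -- Finitely many directed graphs allow one tolerance and one period for all of them, so the DAG
  -- reached need not be known in advance.
  obtain ⟨E₀, hE₀⟩ := Finite.exists_min η
  choose B hB using fun (T₀ : ℕ) (R : ℝ) => (Set.finite_range fun E => T₁ E T₀ R).bddAbove
  refine ⟨η E₀, hη E₀, B, fun T₀ R E hE hlam rank A t Q hr hA hQ hd hconv hR T hT => ?_⟩
  ext n
  simp only [marked, Finset.mem_filter, Finset.mem_univ, true_and]
  constructor
  · rintro ⟨τ, _, hτ⟩
    by_contra hn
    exact not_lt.2 ((bpQueue_le_backlogBound hE.cap_nonneg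
      (W.isSmallestMinCut_smallestMinCut E).1 t hQ hd τ hn).trans hR) hτ
  · intro hn
    obtain ⟨τ, hτ, h⟩ := hT₁ E T₀ R hE hlam rank A t Q hr hA hQ
      (fun τ hτ => (hconv τ hτ).trans (by gcongr; exact hE₀ E)) n hn
    exact ⟨τ, hτ.trans_le ((hB T₀ R ⟨E, rfl⟩).trans hT), h⟩

section LFBP

variable {W} {rank : ℕ → N → N → ℕ} {A : ℕ → ℝ} {Q₀ : N → ℝ} {T : ℕ → ℕ} {R : ℕ → ℝ}

theorem isEmbeddedDAG_lfbp (k : ℕ) : W.IsEmbeddedDAG (W.lfbp rank A Q₀ T R k).links := by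
  induction k with
  | zero => exact W.isEmbeddedDAG_initialDAG
  | succ k ih => exact ih.reverseMarked _

theorem lfbp_queue_nonneg (hr : ∀ t i, Function.Injective (rank t i)) (hA : ∀ t, 0 ≤ A t)
    (hQ : ∀ n, 0 ≤ Q₀ n) (k : ℕ) (n : N) : 0 ≤ (W.lfbp rank A Q₀ T R k).queue n := by
  induction k generalizing n with
  | zero => exact hQ n
  | succ k ih => exact bpQueue_nonneg (isEmbeddedDAG_lfbp k).cap_nonneg hr hA _ ih _ n

theorem lfbp_queue_dest (hd : Q₀ W.d = 0) (k : ℕ) : (W.lfbp rank A Q₀ T R k).queue W.d = 0 := by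
  induction k with
  | zero => exact hd
  | succ k ih => exact bpQueue_dest _ ih _

/-- The bound does not involve the DAGs that are visited, so thresholds fixed in advance can be
compared with it. -/
theorem sum_lfbp_queue_le (hr : ∀ t i, Function.Injective (rank t i)) (hA : ∀ t, 0 ≤ A t)
    (hQ : ∀ n, 0 ≤ Q₀ n) (hd : Q₀ W.d = 0) (k : ℕ) :
    ∑ n, (W.lfbp rank A Q₀ T R k).queue n ≤
      ∑ n, Q₀ n + ∑ i ∈ Finset.range (W.lfbp rank A Q₀ T R k).time, A i := by
  induction k with
  | zero => simp [lfbp]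
  | succ k ih =>
    have h := sum_bpQueue_le (Q := (W.lfbp rank A Q₀ T R k).queue) (isEmbeddedDAG_lfbp (T := T)
      (R := R) (Q₀ := Q₀) (rank := rank) (A := A) k).cap_nonneg hr hA
      (W.lfbp rank A Q₀ T R k).time (lfbp_queue_nonneg hr hA hQ k) (lfbp_queue_dest hd k) (T k)
    change ∑ n, W.bpQueue rank A (W.lfbp rank A Q₀ T R k).links (W.lfbp rank A Q₀ T R k).time
      (W.lfbp rank A Q₀ T R k).queue (T k) n ≤
      ∑ n, Q₀ n + ∑ i ∈ Finset.range ((W.lfbp rank A Q₀ T R k).time + T k), A i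
    rw [Finset.sum_range_add]
    linarith

theorem lfbp_links_succ {k : ℕ} (h : LFBPState.marked W (W.lfbp rank A Q₀ T R k) rank A (T k) (R k)
      = W.smallestMinCut (W.lfbp rank A Q₀ T R k).links) :
    (W.lfbp rank A Q₀ T R (k + 1)).links = W.reverseStep (W.lfbp rank A Q₀ T R k).links := by
  rw [reverseStep, ← h]; rfl

/-- LFBP follows the link-reversal algorithm as long as it marks the smallest min-cuts. -/
theorem isCorrectRun_of_marked_eq {lam : ℝ} {K : ℕ}
    (hK : lam ≤ W.maxFlow (W.reverseStep^[K] W.initialDAG))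
    (hlt : ∀ k < K, W.maxFlow (W.reverseStep^[k] W.initialDAG) < lam)
    (h : ∀ k < K, W.maxFlow (W.lfbp rank A Q₀ T R k).links < lam →
      LFBPState.marked W (W.lfbp rank A Q₀ T R k) rank A (T k) (R k)
        = W.smallestMinCut (W.lfbp rank A Q₀ T R k).links) :
    W.IsCorrectRun lam rank A Q₀ T R K := by
  have hlinks : ∀ k ≤ K, (W.lfbp rank A Q₀ T R k).links = W.reverseStep^[k] W.initialDAG := by
    intro k
    induction k with
    | zero => exact fun _ => rfl
    | succ k ih =>
      intro hk
      have ih := ih (Nat.le_of_succ_le hk)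
      rw [lfbp_links_succ (h k hk (ih ▸ hlt k hk)), ih, Function.iterate_succ_apply']
  have hns : ∀ k < K, W.maxFlow (W.lfbp rank A Q₀ T R k).links < lam :=
    fun k hk => hlinks k hk.le ▸ hlt k hk
  have hcap := fun k => (isEmbeddedDAG_lfbp (W := W) (rank := rank) (A := A) (Q₀ := Q₀) (T := T)
    (R := R) k).cap_nonneg
  have hX := fun k => W.isSmallestMinCut_smallestMinCut (W.lfbp rank A Q₀ T R k).links
  have hcut : ∀ k < K, W.cutCap (W.lfbp rank A Q₀ T R k).links
      (W.smallestMinCut (W.lfbp rank A Q₀ T R k).links) < lam := fun k hk => by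
    rw [← not_le, ← le_maxFlow_iff (hcap k) (hX k).1]; exact not_le.2 (hns k hk)
  exact
    { dag := fun k _ => isEmbeddedDAG_lfbp k
      supports := hlinks K le_rfl ▸ hK
      not_supports := hns
      smallest_min_cut := fun k hk X => by
        rw [h k hk (hns k hk)]
        exact ⟨fun hX' => hX'.eq (hcap k) (hX k), fun hX' => hX' ▸ hX k⟩
      exists_lexMin := fun k hk => exists_isLexMinOverload (hcap k)
        ((flux_nonneg (hcap k) _ _).trans (hcut k hk).le)
      overloaded := fun k hk q hq n => by
        rw [h k hk (hns k hk)]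
        exact hq.mem_iff (hcap k) (hX k) (hcut k hk) n
      same_reversals := fun k hk q hq => by
        rw [lfbp_links_succ (h k hk (hns k hk)), reverseStep, linkReversal_eq_reverseMarked hq.1.1
          fun n => hq.mem_iff (hcap k) (hX k) (hcut k hk) n] }

/-- LFBP finds a DAG that supports the arrival rate if it marks the smallest min-cut in all but
finitely many iterations. -/
theorem exists_lfbp_supports {lam : ℝ} (hlam : lam ≤ W.maxFlowG)
    (h : ∀ᶠ k in atTop, W.maxFlow (W.lfbp rank A Q₀ T R k).links < lam →
      LFBPState.marked W (W.lfbp rank A Q₀ T R k) rank A (T k) (R k)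
        = W.smallestMinCut (W.lfbp rank A Q₀ T R k).links) :
    ∃ k, lam ≤ W.maxFlow (W.lfbp rank A Q₀ T R k).links := by
  by_contra! hns
  obtain ⟨k₀, hk₀⟩ := eventually_atTop.1 h
  -- Earlier mistakes are harmless: from `k₀` on, the run is link reversal started at whatever DAG
  -- has been reached.
  have hlinks : ∀ j, (W.lfbp rank A Q₀ T R (k₀ + j)).links =
      W.reverseStep^[j] (W.lfbp rank A Q₀ T R k₀).links := by
    intro j
    induction j with
    | zero => rfl
    | succ j ih =>
      rw [Function.iterate_succ_apply', ← ih]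
      exact lfbp_links_succ (hk₀ (k₀ + j) (Nat.le_add_right _ _) (hns _))
  obtain ⟨j, hj⟩ := W.exists_iterate_supports hlam
    (isEmbeddedDAG_lfbp (rank := rank) (A := A) (Q₀ := Q₀) (T := T) (R := R) k₀)
  exact absurd (hlinks j ▸ hns (k₀ + j)) (not_lt.2 hj)

end LFBP

end Network

/-! ### Averages of arrivals -/

/-- The error of a window is the difference of two errors counted from time zero. The later one is
at most `η / 2 * (t + τ)`; the earlier one and the shift `t` are fixed and absorbed once `τ` is
large. -/
theorem abs_sum_range_add_sub_le_of_tendsto {A : ℕ → ℝ} {lam : ℝ}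
    (h : Tendsto (fun t : ℕ => (∑ τ ∈ Finset.range t, A τ) / (t : ℝ)) atTop (𝓝 lam)) (t : ℕ)
    {η : ℝ} (hη : 0 < η) :
    ∃ T₀ : ℕ, ∀ τ ≥ T₀, |∑ i ∈ Finset.range τ, A (t + i) - lam * τ| ≤ η * τ := by
  obtain ⟨T', hT'⟩ := Metric.tendsto_atTop.1 h (η / 2) (half_pos hη)
  have hsum : ∀ n ≥ max T' 1, |∑ i ∈ Finset.range n, A i - lam * n| ≤ η / 2 * n := by
    intro n hn
    have hn0 : (0 : ℝ) < n := by exact_mod_cast (le_max_right _ _).trans hn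
    have h1 := (hT' n ((le_max_left _ _).trans hn)).le
    rw [Real.dist_eq] at h1
    have h2 : ∑ i ∈ Finset.range n, A i - lam * n =
        ((∑ i ∈ Finset.range n, A i) / n - lam) * n := by field_simp
    rw [h2, abs_mul, abs_of_pos hn0]
    gcongr
  obtain ⟨T'', hT''⟩ := exists_nat_ge (t + |∑ i ∈ Finset.range t, A i - lam * t| / (η / 2))
  refine ⟨max (max T' 1) T'', fun τ hτ => ?_⟩
  have h1 := hsum (t + τ) (((le_max_left _ _).trans hτ).trans (Nat.le_add_left _ _))
  have h2 : (T'' : ℝ) ≤ τ := by exact_mod_cast (le_max_right _ _).trans hτ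
  have h3 := hT''.trans h2
  rw [← le_sub_iff_add_le', div_le_iff₀ (half_pos hη)] at h3
  have h4 : ∑ i ∈ Finset.range τ, A (t + i) - lam * τ =
      (∑ i ∈ Finset.range (t + τ), A i - lam * (t + τ : ℕ)) -
        (∑ i ∈ Finset.range t, A i - lam * t) := by
    rw [Finset.sum_range_add]; push_cast; ring
  rw [h4]
  refine (abs_sub _ _).trans ?_
  push_cast at h1 ⊢
  linarith

/-- Continuity from above, used to replace path-dependent constants by deterministic ones outside an
event of small probability. -/
theorem exists_measure_le_of_antitone {Ω : Type*} [MeasurableSpace Ω] {P : Measure Ω}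
    [IsFiniteMeasure P] {B : ℕ → Set Ω} (hB : ∀ n, MeasurableSet (B n)) (hanti : Antitone B)
    (hne : ∀ᵐ ω ∂P, ∃ n, ω ∉ B n) {ε : ENNReal} (hε : 0 < ε) : ∃ n, P (B n) ≤ ε := by
  have h := tendsto_measure_iInter_atTop (μ := P) (fun n => (hB n).nullMeasurableSet) hanti
    ⟨0, measure_ne_top P _⟩
  have h0 : P (⋂ n, B n) = 0 := by
    rw [measure_eq_zero_iff_ae_notMem]
    filter_upwards [hne] with ω ⟨n, hn⟩ hω
    exact hn (Set.mem_iInter.1 hω n)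
  rw [h0] at h
  exact ((h.eventually_lt_const hε).exists).imp fun _ h => h.le

/-- With probability close to one, the arrivals up to time `t` are bounded and their later
averages are close to the rate from some time on. -/
theorem exists_measure_arrivals_le {Ω : Type*} [MeasurableSpace Ω] {P : Measure Ω}
    [IsProbabilityMeasure P] {A : ℕ → Ω → ℝ} (hAm : ∀ t, Measurable (A t)) {lam : ℝ}
    (hconv : ∀ᵐ ω ∂P, Tendsto (fun t : ℕ => (∑ τ ∈ Finset.range t, A τ ω) / (t : ℝ)) atTop
      (𝓝 lam)) {η : ℝ} (hη : 0 < η) (b : ℝ) (t : ℕ) {ε : ENNReal} (hε : 0 < ε) :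
    ∃ (R : ℝ) (T₀ : ℕ), P {ω | ¬ (b + ∑ i ∈ Finset.range t, A i ω ≤ R ∧
      ∀ τ ≥ T₀, |∑ i ∈ Finset.range τ, A (t + i) ω - lam * τ| ≤ η * τ)} ≤ ε := by
  obtain ⟨R, hR⟩ := exists_measure_le_of_antitone (P := P)
    (B := fun n : ℕ => {ω | (n : ℝ) < b + ∑ i ∈ Finset.range t, A i ω})
    (fun n => measurableSet_lt measurable_const
      (measurable_const.add (Finset.measurable_fun_sum _ fun i _ => hAm i)))
    (fun m n hmn ω (hω : (n : ℝ) < _) => lt_of_le_of_lt (Nat.cast_le.2 hmn) hω)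
    (Eventually.of_forall fun ω => (exists_nat_ge (b + ∑ i ∈ Finset.range t, A i ω)).imp
      fun _ h => not_lt.2 h) (ENNReal.half_pos hε.ne')
  obtain ⟨T₀, hT₀⟩ := exists_measure_le_of_antitone (P := P)
    (B := fun n : ℕ => ⋃ τ ∈ Set.Ici n,
      {ω | η * (τ : ℝ) < |∑ i ∈ Finset.range τ, A (t + i) ω - lam * τ|})
    (fun n => MeasurableSet.biUnion (Set.to_countable _) fun τ _ => measurableSet_lt
      measurable_const
      ((Finset.measurable_fun_sum _ fun i _ => hAm (t + i)).sub measurable_const).abs)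
    (fun m n hmn => Set.biUnion_subset_biUnion_left (Set.Ici_subset_Ici.2 hmn))
    (by
      filter_upwards [hconv] with ω hω
      obtain ⟨T₀, hT₀⟩ := abs_sum_range_add_sub_le_of_tendsto hω t hη
      refine ⟨T₀, fun h => ?_⟩
      obtain ⟨τ, hτ, h⟩ := Set.mem_iUnion₂.1 h
      exact not_lt.2 (hT₀ τ hτ) h) (ENNReal.half_pos hε.ne')
  refine ⟨R, T₀, (measure_mono fun ω hω => ?_).trans ((measure_union_le _ _).trans
    ((add_le_add hR hT₀).trans (ENNReal.add_halves ε).le))⟩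
  by_contra h
  simp only [Set.mem_union, Set.mem_iUnion, not_or, not_exists, Set.mem_ofPred_eq, not_lt,
    Set.mem_Ici] at h
  exact hω ⟨h.1, h.2⟩

/-! ### Choice of thresholds and periods. -/

theorem corollary1 {N : Type*} [Fintype N] (W : Network N) (lam : ℝ)
    (hlam : lam ≤ W.maxFlowG) :
    -- the number of iterations and the detection thresholds do not depend on the arrivals
    ∃ (K : ℕ) (Rmin : (N → N → Prop) → (N → ℝ) → ℝ),
      ∀ (Ω : Type*) [MeasurableSpace Ω] (P : Measure Ω) [IsProbabilityMeasure P]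
        (A : ℕ → Ω → ℝ),
        (∀ t, Measurable (A t)) →
        (∀ t ω, 0 ≤ A t ω) →
        (∀ᵐ ω ∂P, Tendsto (fun t : ℕ => (∑ τ ∈ Finset.range t, A τ ω) / (t : ℝ)) atTop
          (𝓝 lam)) →
        ∀ (rank : ℕ → N → N → ℕ), (∀ t i, Function.Injective (rank t i)) →
        ∀ (Q₀ : N → ℝ), (∀ n, 0 ≤ Q₀ n) → Q₀ W.d = 0 →
          -- along almost every sample path: all sufficiently large thresholds and periods work
          (∀ᵐ ω ∂P, ∃ Tmin : ℕ → (N → N → Prop) → (N → ℝ) → ℝ → ℕ,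
            ∀ (T : ℕ → ℕ) (R : ℕ → ℝ),
              (∀ k < K,
                let S := W.lfbp rank (fun t => A t ω) Q₀ T R k
                Rmin S.links S.queue ≤ R k ∧ Tmin S.time S.links S.queue (R k) ≤ T k) →
              W.IsCorrectRun lam rank (fun t => A t ω) Q₀ T R K) ∧
          -- thresholds and periods fixed in advance
          (∀ ε : ℝ, 0 < ε → ∃ (T : ℕ → ℕ) (R : ℕ → ℝ), (∀ k, 0 < T k) ∧
            (∀ᵐ ω ∂P, ∃ k,
              W.IsEmbeddedDAG (W.lfbp rank (fun t => A t ω) Q₀ T R k).links ∧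
              lam ≤ W.maxFlow (W.lfbp rank (fun t => A t ω) Q₀ T R k).links) ∧
            P {ω | ¬ W.IsCorrectRun lam rank (fun t => A t ω) Q₀ T R K} ≤ ENNReal.ofReal ε) := by
  obtain ⟨η, hη, T₁, hT₁⟩ := W.exists_marked_eq lam
  have hex := W.exists_iterate_supports hlam W.isEmbeddedDAG_initialDAG
  refine ⟨Nat.find hex, fun _ Q => W.backlogBound Q, ?_⟩
  intro Ω _ P _ A hAm hA hconv rank hr Q₀ hQ hd
  have hlt : ∀ k < Nat.find hex, W.maxFlow (W.reverseStep^[k] W.initialDAG) < lam :=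
    fun k hk => not_le.1 (Nat.find_min hex hk)
  constructor
  · filter_upwards [hconv] with ω hω
    choose T₀ hT₀ using fun t => abs_sum_range_add_sub_le_of_tendsto hω t hη
    refine ⟨fun t _ _ r => T₁ (T₀ t) r, fun T R hTR => ?_⟩
    refine Network.isCorrectRun_of_marked_eq (Nat.find_spec hex) hlt fun k hk hns => ?_
    exact hT₁ _ _ _ (Network.isEmbeddedDAG_lfbp k) hns rank _ _ _ hr (fun t => hA t ω)
      (Network.lfbp_queue_nonneg hr (fun t => hA t ω) hQ k) (Network.lfbp_queue_dest hd k)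
      (hT₀ _) (hTR k hk).1 _ (hTR k hk).2
  · intro ε hε
    obtain ⟨e, he0, he⟩ := ENNReal.exists_pos_sum_of_countable
      (ENNReal.ofReal_pos.2 hε).ne' ℕ
    choose r T₀ hbad using fun (k t : ℕ) => exists_measure_arrivals_le hAm hconv hη
      (W.backlogBound Q₀) t (ENNReal.coe_pos.2 (he0 k))
    -- The starting times are fixed by recursion, since the constants for iteration `k` depend on
    -- when it starts; the maximum with one keeps the periods positive.
    let time : ℕ → ℕ := fun k => Nat.rec 0 (fun k t => t + max 1 (T₁ (T₀ k t) (r k t))) k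
    let T : ℕ → ℕ := fun k => max 1 (T₁ (T₀ k (time k)) (r k (time k)))
    let R : ℕ → ℝ := fun k => r k (time k)
    have htime : ∀ ω k, (W.lfbp rank (fun t => A t ω) Q₀ T R k).time = time k := by
      intro ω k
      induction k with
      | zero => rfl
      | succ k ih => exact congrArg (· + T k) ih
    let bad : ℕ → Set Ω := fun k =>
      {ω | ¬ (W.backlogBound Q₀ + ∑ i ∈ Finset.range (time k), A i ω ≤ R k ∧
        ∀ τ ≥ T₀ k (time k),
          |∑ i ∈ Finset.range τ, A (time k + i) ω - lam * τ| ≤ η * τ)}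
    have hgood : ∀ ω k, ω ∉ bad k →
        W.maxFlow (W.lfbp rank (fun t => A t ω) Q₀ T R k).links < lam →
        Network.LFBPState.marked W (W.lfbp rank (fun t => A t ω) Q₀ T R k) rank
          (fun t => A t ω) (T k) (R k) =
          W.smallestMinCut (W.lfbp rank (fun t => A t ω) Q₀ T R k).links := by
      intro ω k hω hns
      obtain ⟨h1, h2⟩ := not_not.1 hω
      refine hT₁ (T₀ k (time k)) _ _ (Network.isEmbeddedDAG_lfbp k) hns rank _ _ _ hr
        (fun t => hA t ω) (Network.lfbp_queue_nonneg hr (fun t => hA t ω) hQ k)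
        (Network.lfbp_queue_dest hd k) ?_ ?_ _ (le_max_right _ _)
      · rw [htime]; exact h2
      -- `backlogBound` depends on the backlogs only through their sum, so the current bound is at
      -- most the initial one plus all arrivals so far.
      · have h3 := Network.sum_lfbp_queue_le (W := W) (T := T) (R := R) hr (fun t => hA t ω)
          hQ hd k
        rw [htime] at h3
        unfold Network.backlogBound at h1 ⊢
        linarith
    have hsum : ∑' k, P (bad k) ≤ ENNReal.ofReal ε :=
      (ENNReal.tsum_le_tsum fun k => hbad k (time k)).trans he.le
    refine ⟨T, R, fun k => lt_of_lt_of_le one_pos (le_max_left _ _), ?_, ?_⟩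
    -- Borel–Cantelli: almost surely only finitely many iterations are bad, which suffices for
    -- eventually finding a supporting DAG.
    · filter_upwards [ae_eventually_notMem (hsum.trans_lt ENNReal.ofReal_lt_top).ne] with ω hω
      obtain ⟨k, hk⟩ := Network.exists_lfbp_supports hlam (hω.mono fun k hk => hgood ω k hk)
      exact ⟨k, Network.isEmbeddedDAG_lfbp k, hk⟩
    -- Union bound: outside all bad events every iteration that needs a reversal marks the smallest
    -- min-cut.
    · refine (measure_mono fun ω hω => ?_).trans ((measure_iUnion_le bad).trans hsum)
      by_contra h
      rw [Set.mem_iUnion, not_exists] at h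
      exact hω (Network.isCorrectRun_of_marked_eq (Nat.find_spec hex) hlt
        fun k _ => hgood ω k (h k))
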